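/- Let $n\ge 2$ and let $T=E_0E_1\cdots E_n$ be a totally asymptotic (all vertices ideal) regular simplex in hyperbolic $n$-space $\mathbf H^n$ of curvature $-1$, where regular means that the symmetry group of $T$ acts transitively on the faces of $T$ of each dimension. Call $\mathcal B=(B_0,\dots,B_n)$ an admissible arrangement if each $B_i$ is a closed horoball centred at $E_i$, the $B_i$ have pairwise disjoint interiors, and each $B_i$ meets the hyperplane spanned by the vertices $E_j$, $j\ne i$, in at most one point. The generalized simplicial density of $\mathcal B$ is $$\delta(\mathcal B)=\frac{\sum_{i=0}^n \mathrm{vol}(B_i\cap T)}{\mathrm{vol}(T)},$$ where $0<\mathrm{vol}(T)<\infty$. An admissible arrangement is optimal if its density is maximal among all admissible arrangements. Let $\mathcal B_0^n$ be the arrangement of horoballs centred at the vertices that are of the same type ($\mathrm{vol}(B_i\cap T)$ does not depend on $i$) and any two of which are tangent. For a vertex $E_k$, let $\mathcal B_1^n$ (with large horoball at $E_k$) be the arrangement of horoballs centred at the vertices in which $B_k$ is tangent to the hyperplane of the opposite face of $T$ and every other $B_i$ is tangent to $B_k$. Let $q_n=\log\sqrt{2n/(n-1)}$. Let $d_n(\infty)=(n+1)\,\mathrm{vol}(B\cap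 T')/\mathrm{vol}(T')$, where $B$ is one of $n+1$ mutually tangent horoballs of the same type centred at the vertices of a totally asymptotic regular simplex $T'$. Then: 1. $\mathcal B_0^n$ exists and is unique, and for each $k$ the arrangement $\mathcal B_1^n$ with large horoball at $E_k$ exists and is unique. For $i\ne k$, the hyperbolic distance between the tangency point of $B_i$ and $B_k$ in $\mathcal B_0^n$ and that in $\mathcal B_1^n$ (with large horoball at $E_k$) is $q_n$. 2. If $n=2$ or $n=3$, then $q_n=\frac{1}{n-1}\log n$, and the optimal arrangements are exactly $\mathcal B_0^n$ and the arrangements $\mathcal B_1^n$ (with large horoball at any of the vertices). 3. If $n\ge 4$, then $q_n>\frac1{n-1}\log n$, and the optimal arrangements are exactly the arrangements $\mathcal B_1^n$ (with large horoball at any of the vertices). 4. The number $d_n(\infty)$ is well defined (it does not depend on the choices), and if $n\ge4$ then $\delta(\mathcal B)>d_n(\infty)$ for every optimal arrangement $\mathcal B$. -/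

import Mathlib

open scoped ENNReal

namespace HoroballSimplex

noncomputable section

/-- The vector space underlying the Lorentz space `E^{1,n}`. -/
abbrev LVec (n : ℕ) : Type := Fin (n + 1) → ℝ

/-- The Lorentz form `-x⁰y⁰ + x¹y¹ + ⋯ + xⁿyⁿ`. -/
def lor {n : ℕ} (x y : LVec n) : ℝ :=
  -(x 0 * y 0) + ∑ i : Fin n, x i.succ * y i.succ

/-- Hyperbolic `n`-space of curvature `-1`. Each proper point of the projective model is
represented by its unique representative with `⟨x, x⟩ = -1` and `x⁰ > 0`; the topology is the
subspace topology. -/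
def Hyp (n : ℕ) : Type := {x : LVec n // lor x x = -1 ∧ 0 < x 0}

instance (n : ℕ) : TopologicalSpace (Hyp n) :=
  inferInstanceAs (TopologicalSpace {x : LVec n // lor x x = -1 ∧ 0 < x 0})

/-- The hyperbolic distance, `cosh s = -⟨x, y⟩`. -/
def hdist {n : ℕ} (x y : Hyp n) : ℝ := Real.arcosh (-(lor x.1 y.1))

/-- Hyperbolic volume. In polar form `v = r • x` (`r > 0`, `x` on the hyperboloid), Lebesgue
measure on the future cone is `rⁿ dr dvol(x)`, so the volume of `A` is `n + 1` times the Lebesgue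
measure of the cone over `A` (as for the surface measure `MeasureTheory.Measure.toSphere`). -/
def hypVol {n : ℕ} (A : Set (Hyp n)) : ℝ≥0∞ :=
  (n + 1 : ℝ≥0∞) *
    MeasureTheory.volume {v : LVec n | ∃ x ∈ A, ∃ r : ℝ, 0 < r ∧ r ≤ 1 ∧ v = r • x.1}

/-- Isometries of hyperbolic space: the linear automorphisms that preserve the Lorentz form and
the sheet `Hyp n`. They act on the ideal points too. -/
def IsIsometry {n : ℕ} (g : LVec n ≃ₗ[ℝ] LVec n) : Prop :=
  (∀ x y, lor (g x) (g y) = lor x y) ∧ ∀ x : Hyp n, 0 < (g x.1) 0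

/-- `e` represents an ideal point: it is a light-like vector with `e⁰ > 0`. Positive multiples
represent the same ideal point. -/
def IsIdealPoint {n : ℕ} (e : LVec n) : Prop := lor e e = 0 ∧ 0 < e 0

/-- `B` is a (closed) horoball centred at the ideal point `[e]`. -/
def IsHoroball {n : ℕ} (e : LVec n) (B : Set (Hyp n)) : Prop :=
  ∃ t : ℝ, 0 < t ∧ B = {x : Hyp n | -(lor x.1 e) ≤ t}

/-- `E` lists the vertices of a (nondegenerate) totally asymptotic simplex. -/
def IsIdealSimplex {n : ℕ} (E : Fin (n + 1) → LVec n) : Prop :=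
  (∀ i, IsIdealPoint (E i)) ∧ LinearIndependent ℝ E

/-- The proper points of the simplex with ideal vertices `E`, the hyperbolic convex hull. -/
def simplex {n : ℕ} (E : Fin (n + 1) → LVec n) : Set (Hyp n) :=
  {x | ∃ a : Fin (n + 1) → ℝ, (∀ i, 0 ≤ a i) ∧ x.1 = ∑ i, a i • E i}

/-- The hyperplane through all vertices other than `E i`. -/
def oppositeHyperplane {n : ℕ} (E : Fin (n + 1) → LVec n) (i : Fin (n + 1)) : Set (Hyp n) :=
  {x | x.1 ∈ Submodule.span ℝ (E '' {j | j ≠ i})}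

/-- The isometry `g` is a symmetry of the simplex, inducing the permutation `σ` of its vertices. -/
def IsSymmetry {n : ℕ} (E : Fin (n + 1) → LVec n) (g : LVec n ≃ₗ[ℝ] LVec n)
    (σ : Equiv.Perm (Fin (n + 1))) : Prop :=
  IsIsometry g ∧ ∀ i, ∃ c : ℝ, 0 < c ∧ g (E i) = c • E (σ i)

/-- A totally asymptotic simplex is regular if its symmetry group acts transitively on its faces
of each dimension; a `k`-face is given by its set of `k + 1` vertices. -/
def IsRegularIdealSimplex {n : ℕ} (E : Fin (n + 1) → LVec n) : Prop :=
  IsIdealSimplex E ∧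
    ∀ S S' : Finset (Fin (n + 1)), S.card = S'.card →
      ∃ g σ, IsSymmetry E g σ ∧ S.image σ = S'

/-- Two sets touch: they meet in exactly one point. For horoballs with different centres, and for
a horoball and a hyperplane not through its centre, this is tangency (`n ≥ 2`). -/
def Touch {n : ℕ} (A B : Set (Hyp n)) : Prop := ∃ p, A ∩ B = {p}

/-- The horoball arrangements admitted in the generalized simplicial density: horoballs centred
at the vertices that do not overlap and each of which meets the hyperplane of the opposite face
in at most one point. -/
structure IsAdmissible {n : ℕ} (E : Fin (n + 1) → LVec n) (B : Fin (n + 1) → Set (Hyp n)) :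
    Prop where
  horoball : ∀ i, IsHoroball (E i) (B i)
  packing : ∀ i j, i ≠ j → Disjoint (interior (B i)) (interior (B j))
  face : ∀ i, (B i ∩ oppositeHyperplane E i).encard ≤ 1

/-- The generalized simplicial density `(∑ vol (B i ∩ T)) / vol T`. -/
def density {n : ℕ} (E : Fin (n + 1) → LVec n) (B : Fin (n + 1) → Set (Hyp n)) : ℝ :=
  (∑ i, (hypVol (B i ∩ simplex E)).toReal) / (hypVol (simplex E)).toReal

/-- `B` attains the maximal generalized simplicial density. -/
def IsOptimal {n : ℕ} (E : Fin (n + 1) → LVec n) (B : Fin (n + 1) → Set (Hyp n)) : Prop :=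
  IsAdmissible E B ∧ ∀ B', IsAdmissible E B' → density E B' ≤ density E B

/-- The configuration `B_0^n`: horoballs of the same type (equal volumes in the simplex), any two
of which touch. -/
structure IsEqualType {n : ℕ} (E : Fin (n + 1) → LVec n) (B : Fin (n + 1) → Set (Hyp n)) :
    Prop where
  horoball : ∀ i, IsHoroball (E i) (B i)
  same_type : ∀ i j, hypVol (B i ∩ simplex E) = hypVol (B j ∩ simplex E)
  touch : ∀ i j, i ≠ j → Touch (B i) (B j)

/-- The configuration `B_1^n` with the large horoball at `E k`: it touches the opposite face, and
all other horoballs touch it. -/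
structure IsOneMaximal {n : ℕ} (E : Fin (n + 1) → LVec n) (k : Fin (n + 1))
    (B : Fin (n + 1) → Set (Hyp n)) : Prop where
  horoball : ∀ i, IsHoroball (E i) (B i)
  touch_face : Touch (B k) (oppositeHyperplane E k)
  touch : ∀ i, i ≠ k → Touch (B i) (B k)

/-- `d` is the simplicial horoball density `d_n(∞) = (n + 1) vol (B ∩ T) / vol T`, where `B` is one
of `n + 1` mutually tangent horoballs of the same type and `T` is the regular simplex spanned by
their centres. -/
def IsClassicalDensity (n : ℕ) (d : ℝ) : Prop :=
  ∃ (E : Fin (n + 1) → LVec n) (B : Fin (n + 1) → Set (Hyp n)),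
    IsRegularIdealSimplex E ∧ IsEqualType E B ∧
      ∀ i, d = (n + 1) * ((hypVol (B i ∩ simplex E)).toReal / (hypVol (simplex E)).toReal)

/-- `q_n = log √(2n/(n-1))`. -/
def q (n : ℕ) : ℝ := Real.log (√(2 * n / (n - 1)))

end

end HoroballSimplex

/-!
By regularity the light-like vectors representing the vertices can be rescaled so that the Lorentz
product of any two of them is `-2`: the logarithms of the products form a function on the edges that
a group acting transitively on the edges preserves up to sums of vertex functions, and averaging
makes it such a sum up to a constant. Horoballs at the vertices are then given by levels `t i > 0`.
Those at `i` and `j` have disjoint interiors iff `t i * t j ≤ 1` and touch iff equality holds; the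
one at `i` does not cross the opposite face iff `t i ^ 2 ≤ 2n/(n-1)`, again with equality for
touching.

Under the latter condition the horoball is bounded within the simplex only by faces through its
centre, so the volume it cuts out is proportional to `x i = t i ^ (n-1)`. One thus has to maximize
`∑ x i` subject to `x i * x j ≤ 1` for `i ≠ j` and `x i ≤ M`, where `M = (2n/(n-1)) ^ ((n-1)/2)`.
If `y ≥ 1` is the largest entry the others are at most `1/y`, so the sum is at most `y + n/y`. This
is convex in `y`, hence maximal at `y = 1` (equal horoballs) or `y = M` (one maximal horoball), and
the latter is at least as good iff `M ≥ n`. Here `log M = (n-1) q n`, with `M = n` for `n = 2, 3`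
and `M > n` for `n ≥ 4`.
-/

namespace HoroballSimplex

open MeasureTheory

variable {n : ℕ}

section LorentzForm

variable {e f v w x y : LVec n}

theorem lor_comm (x y : LVec n) : lor x y = lor y x := by
  simp only [lor, mul_comm]

theorem lor_add_left (x y z : LVec n) : lor (x + y) z = lor x z + lor y z := by
  simp only [lor, Pi.add_apply, add_mul, Finset.sum_add_distrib]
  ring

theorem lor_smul_left (c : ℝ) (x y : LVec n) : lor (c • x) y = c * lor x y := by
  simp only [lor, Pi.smul_apply, smul_eq_mul, mul_assoc, ← Finset.mul_sum]
  ring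

/-- The Lorentz form `lor` as a bilinear form, which gives access to the linear algebra library. -/
def lorForm : LinearMap.BilinForm ℝ (LVec n) :=
  LinearMap.mk₂ ℝ lor lor_add_left lor_smul_left
    (fun x y z => by simp only [lor_comm x, lor_add_left])
    (fun c x y => by simp only [lor_comm x, lor_smul_left, smul_eq_mul])

theorem lor_add_right (x y z : LVec n) : lor x (y + z) = lor x y + lor x z :=
  map_add (lorForm x) y z

theorem lor_smul_right (c : ℝ) (x y : LVec n) : lor x (c • y) = c * lor x y :=
  map_smul (lorForm x) c y

theorem lor_neg_left (x y : LVec n) : lor (-x) y = -lor x y :=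
  LinearMap.map_neg₂ lorForm x y

theorem lor_sub_left (x y z : LVec n) : lor (x - y) z = lor x z - lor y z :=
  LinearMap.map_sub₂ lorForm x y z

theorem lor_sub_right (x y z : LVec n) : lor x (y - z) = lor x y - lor x z :=
  map_sub (lorForm x) y z

theorem lor_sum_left {ι : Type*} (s : Finset ι) (x : ι → LVec n) (y : LVec n) :
    lor (∑ i ∈ s, x i) y = ∑ i ∈ s, lor (x i) y :=
  LinearMap.map_sum₂ lorForm s x y

theorem lor_sum_right {ι : Type*} (s : Finset ι) (x : LVec n) (y : ι → LVec n) :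
    lor x (∑ i ∈ s, y i) = ∑ i ∈ s, lor x (y i) :=
  map_sum (lorForm x) y s

theorem continuous_lor_left (y : LVec n) : Continuous fun x => lor x y := by
  unfold lor
  fun_prop

theorem sum_sq_eq_lor (x y : LVec n) :
    ∑ i : Fin n, (y 0 * x i.succ - x 0 * y i.succ) ^ 2 =
      y 0 ^ 2 * lor x x + x 0 ^ 2 * lor y y - 2 * (x 0 * y 0) * lor x y := by
  have expand : ∀ i : Fin n, (y 0 * x i.succ - x 0 * y i.succ) ^ 2 =
      y 0 ^ 2 * (x i.succ * x i.succ) + x 0 ^ 2 * (y i.succ * y i.succ) -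
        2 * (x 0 * y 0) * (x i.succ * y i.succ) := fun i => by ring
  simp only [expand, Finset.sum_sub_distrib, Finset.sum_add_distrib, ← Finset.mul_sum, lor]
  ring

theorem smul_eq_smul_of_sum_sq_eq_zero
    (h : ∑ i : Fin n, (y 0 * x i.succ - x 0 * y i.succ) ^ 2 = 0) : y 0 • x = x 0 • y := by
  have h := (Finset.sum_eq_zero_iff_of_nonneg fun i _ => sq_nonneg _).1 h
  funext i
  refine Fin.cases (mul_comm _ _) (fun i => ?_) i
  simpa only [Pi.smul_apply, smul_eq_mul] using
    sub_eq_zero.1 (pow_eq_zero_iff two_ne_zero |>.1 (h i (Finset.mem_univ i)))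

theorem sum_sq_pos (h : y 0 • x ≠ x 0 • y) :
    0 < ∑ i : Fin n, (y 0 * x i.succ - x 0 * y i.succ) ^ 2 :=
  (Finset.sum_nonneg fun _ _ => sq_nonneg _).lt_of_ne' (mt smul_eq_smul_of_sum_sq_eq_zero h)

theorem lor_self_pos (hx : lor x x < 0) (hxv : lor x v = 0) (hv : v ≠ 0) : 0 < lor v v := by
  have hx0 : 0 < x 0 ^ 2 := by
    have : 0 ≤ ∑ i : Fin n, x i.succ * x i.succ := Finset.sum_nonneg fun i _ => mul_self_nonneg _
    rw [lor] at hx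
    nlinarith
  have hsum := sum_sq_eq_lor x v
  have hnonneg := Finset.sum_nonneg
    fun (i : Fin n) (_ : i ∈ Finset.univ) => sq_nonneg (v 0 * x i.succ - x 0 * v i.succ)
  rw [hxv, mul_zero, sub_zero] at hsum
  obtain hv0 | hv0 := eq_or_ne (v 0) 0
  · have hne : v 0 • x ≠ x 0 • v := by
      rw [hv0, zero_smul]
      exact (smul_ne_zero (pow_ne_zero_iff two_ne_zero |>.1 hx0.ne') hv).symm
    have := sum_sq_pos hne
    rw [hv0] at this hsum
    nlinarith
  · have : v 0 ^ 2 * lor x x < 0 := mul_neg_of_pos_of_neg (by positivity) hx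
    nlinarith

theorem lor_self_nonneg (hx : lor x x < 0) (hxv : lor x v = 0) : 0 ≤ lor v v := by
  obtain rfl | hv := eq_or_ne v 0
  · simp [lor]
  · exact (lor_self_pos hx hxv hv).le

theorem Hyp.lor_self (x : Hyp n) : lor x.1 x.1 = -1 := x.2.1

theorem Hyp.lor_residual (x : Hyp n) (w : LVec n) :
    lor x.1 (w + lor x.1 w • x.1) = 0 ∧
      lor (w + lor x.1 w • x.1) (w + lor x.1 w • x.1) = lor w w + lor x.1 w ^ 2 := by
  simp only [lor_add_left, lor_add_right, lor_smul_left, lor_smul_right, x.lor_self,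
    lor_comm w x.1]
  constructor <;> ring

theorem Hyp.neg_lor_self_le_sq (x : Hyp n) (w : LVec n) : -lor w w ≤ lor x.1 w ^ 2 := by
  obtain ⟨horth, hnorm⟩ := x.lor_residual w
  have := lor_self_nonneg (x.lor_self.trans_lt neg_one_lt_zero) horth
  linarith

theorem Hyp.eq_smul_of_sq_eq (x : Hyp n) (h : lor x.1 w ^ 2 = -lor w w) :
    w = -lor x.1 w • x.1 := by
  obtain ⟨horth, hnorm⟩ := x.lor_residual w
  by_contra hw
  have := lor_self_pos (x.lor_self.trans_lt neg_one_lt_zero) horth fun h0 =>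
    hw (by rw [neg_smul]; exact eq_neg_of_add_eq_zero_left h0)
  linarith

theorem lor_neg_of_causal (hx : lor x x ≤ 0) (hx0 : 0 < x 0) (hy : lor y y ≤ 0) (hy0 : 0 < y 0)
    (hxy : y 0 • x ≠ x 0 • y) : lor x y < 0 := by
  have hpos := sum_sq_pos hxy
  rw [sum_sq_eq_lor] at hpos
  have hx' : y 0 ^ 2 * lor x x ≤ 0 := mul_nonpos_of_nonneg_of_nonpos (sq_nonneg _) hx
  have hy' : x 0 ^ 2 * lor y y ≤ 0 := mul_nonpos_of_nonneg_of_nonpos (sq_nonneg _) hy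
  have : 2 * (x 0 * y 0) * lor x y < 0 := by linarith
  exact neg_of_mul_neg_right this (by positivity)

theorem Hyp.lor_neg (x : Hyp n) (he : IsIdealPoint e) : lor x.1 e < 0 := by
  refine lor_neg_of_causal (by rw [x.lor_self]; exact neg_one_lt_zero.le) x.2.2 he.1.le he.2
    fun h => ?_
  have h := congrArg (fun z => lor z z) h
  simp only [lor_smul_left, lor_smul_right, x.lor_self, he.1] at h
  nlinarith [he.2]

theorem IsIdealPoint.smul (he : IsIdealPoint e) {c : ℝ} (hc : 0 < c) : IsIdealPoint (c • e) :=
  ⟨by rw [lor_smul_left, lor_smul_right, he.1, mul_zero, mul_zero], mul_pos hc he.2⟩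

theorem IsIdealPoint.lor_neg (he : IsIdealPoint e) (hf : IsIdealPoint f)
    (hef : LinearIndependent ℝ ![e, f]) : lor e f < 0 := by
  refine lor_neg_of_causal he.1.le he.2 hf.1.le hf.2 fun h => hf.2.ne' ?_
  exact (LinearIndependent.pair_iff.1 hef (f 0) (-e 0)
    (by rw [h, neg_smul, add_neg_cancel])).1

theorem pos_of_lor_neg (hv : lor v v = -1) (he : IsIdealPoint e) (hve : lor v e < 0) :
    0 < v 0 := by
  by_contra! hv0
  obtain hv0 | hv0 := hv0.lt_or_eq
  · have hneg : lor (-v) (-v) = -1 := by rw [lor_neg_left, lor_comm, lor_neg_left, hv, neg_neg]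
    have := Hyp.lor_neg ⟨-v, hneg, neg_pos.2 hv0⟩ he
    rw [lor_neg_left] at this
    linarith
  · have : 0 ≤ ∑ i : Fin n, v i.succ * v i.succ := Finset.sum_nonneg fun i _ => mul_self_nonneg _
    rw [lor, hv0] at hv
    linarith

end LorentzForm

section Horoball

variable {e f : LVec n} {a b s t : ℝ}

/-- The horoball centred at the ideal point `e` and cut out by `-⟨x, e⟩ ≤ t`. Its level `t`
depends on the choice of `e` among the representatives of the ideal point. -/
def horo (e : LVec n) (t : ℝ) : Set (Hyp n) := {x | -lor x.1 e ≤ t}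

theorem mem_horo {x : Hyp n} : x ∈ horo e t ↔ -lor x.1 e ≤ t := Iff.rfl

/-- The point at signed distance `θ` from `x` on the geodesic running from `e` through `x`. -/
noncomputable def rayPoint (he : IsIdealPoint e) (x : Hyp n) (θ : ℝ) : Hyp n :=
  have hxe : lor x.1 e < 0 := x.lor_neg he
  have hye : lor (θ.exp • x.1 + (θ.sinh / lor x.1 e) • e) e = θ.exp * lor x.1 e := by
    rw [lor_add_left, lor_smul_left, lor_smul_left, he.1, mul_zero, add_zero]
  have hy : lor (θ.exp • x.1 + (θ.sinh / lor x.1 e) • e)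
      (θ.exp • x.1 + (θ.sinh / lor x.1 e) • e) = -1 := by
    rw [lor_add_right, lor_smul_right, lor_smul_right, hye, lor_add_left, lor_smul_left,
      lor_smul_left, x.lor_self, lor_comm e, Real.sinh_eq]
    have hexp := Real.exp_add θ (-θ)
    rw [add_neg_cancel, Real.exp_zero] at hexp
    have hne := hxe.ne
    field_simp
    linear_combination 2 * hexp
  ⟨_, hy, pos_of_lor_neg hy he (hye ▸ mul_neg_of_pos_of_neg θ.exp_pos hxe)⟩

theorem lor_rayPoint (he : IsIdealPoint e) (x : Hyp n) (θ : ℝ) :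
    lor (rayPoint he x θ).1 e = θ.exp * lor x.1 e := by
  rw [rayPoint, lor_add_left, lor_smul_left, lor_smul_left, he.1, mul_zero, add_zero]

theorem rayPoint_zero (he : IsIdealPoint e) (x : Hyp n) : rayPoint he x 0 = x :=
  Subtype.ext (by simp [rayPoint])

theorem continuous_rayPoint (he : IsIdealPoint e) (x : Hyp n) : Continuous (rayPoint he x) :=
  Continuous.subtype_mk (by fun_prop) _

theorem interior_horo (he : IsIdealPoint e) (t : ℝ) :
    interior (horo e t) = {x | -lor x.1 e < t} := by
  refine Set.Subset.antisymm (fun x hx => ?_)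
    (interior_maximal (fun x (hx : -lor x.1 e < t) => hx.le)
      (isOpen_lt ((continuous_lor_left e).comp continuous_subtype_val).neg continuous_const))
  have hmem : ∀ᶠ θ in nhds 0, rayPoint he x θ ∈ horo e t := by
    refine (continuous_rayPoint he x).continuousAt ?_
    rw [rayPoint_zero]
    exact mem_interior_iff_mem_nhds.1 hx
  obtain ⟨θ, hθ, hθ0⟩ :=
    ((hmem.filter_mono nhdsWithin_le_nhds).and (self_mem_nhdsWithin (s := Set.Ioi 0))).exists
  rw [mem_horo, lor_rayPoint] at hθ
  have := Real.one_lt_exp_iff.2 hθ0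
  have := x.lor_neg he
  exact lt_of_lt_of_le (by nlinarith) hθ

theorem Hyp.neg_lor_le (x : Hyp n) (he : IsIdealPoint e) (hf : IsIdealPoint f) :
    -lor e f ≤ 2 * (lor x.1 e * lor x.1 f) := by
  have hpos := mul_pos_of_neg_of_neg (x.lor_neg he) (x.lor_neg hf)
  have h := x.neg_lor_self_le_sq (lor x.1 f • e + lor x.1 e • f)
  simp only [lor_add_left, lor_add_right, lor_smul_left, lor_smul_right, he.1, hf.1,
    lor_comm f e] at h
  nlinarith

theorem Hyp.eq_edgePoint (x : Hyp n) (he : IsIdealPoint e) (hf : IsIdealPoint f)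
    (h : 2 * (lor x.1 e * lor x.1 f) = -lor e f) :
    x.1 = (2 * -lor x.1 e)⁻¹ • e + (2 * -lor x.1 f)⁻¹ • f := by
  have hxe := (x.lor_neg he).ne
  have hxf := (x.lor_neg hf).ne
  have hw := x.eq_smul_of_sq_eq (w := lor x.1 f • e + lor x.1 e • f) (by
    simp only [lor_add_left, lor_add_right, lor_smul_left, lor_smul_right, he.1, hf.1,
      lor_comm f e]
    linear_combination 2 * lor x.1 e * lor x.1 f * h)
  have hx : x.1 = (-(2 * (lor x.1 e * lor x.1 f)))⁻¹ • (lor x.1 f • e + lor x.1 e • f) := by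
    rw [eq_inv_smul_iff₀ (by simp [hxe, hxf]), hw, lor_add_right, lor_smul_right, lor_smul_right]
    congr 1
    ring
  refine hx.trans ?_
  rw [smul_add, smul_smul, smul_smul]
  congr 2 <;> field_simp

theorem exists_edgePoint (he : IsIdealPoint e) (hf : IsIdealPoint f) (ha : 0 < a) (hb : 0 < b)
    (hab : 2 * (a * b) = -lor e f) : ∃ x : Hyp n, -lor x.1 e = a ∧ -lor x.1 f = b := by
  have hxe : lor ((2 * a)⁻¹ • e + (2 * b)⁻¹ • f) e = -a := by
    rw [lor_add_left, lor_smul_left, lor_smul_left, he.1, lor_comm f, ← neg_eq_iff_eq_neg.2 hab]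
    field_simp
    ring
  have hxf : lor ((2 * a)⁻¹ • e + (2 * b)⁻¹ • f) f = -b := by
    rw [lor_add_left, lor_smul_left, lor_smul_left, hf.1, ← neg_eq_iff_eq_neg.2 hab]
    field_simp
    ring
  have hx : lor ((2 * a)⁻¹ • e + (2 * b)⁻¹ • f) ((2 * a)⁻¹ • e + (2 * b)⁻¹ • f) = -1 := by
    rw [lor_add_right, lor_smul_right, lor_smul_right, hxe, hxf]
    field_simp
    norm_num
  exact ⟨⟨_, hx, pos_of_lor_neg hx he (by linarith)⟩, by linarith, by linarith⟩

theorem horo_inter_horo_nonempty_iff (he : IsIdealPoint e) (hf : IsIdealPoint f)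
    (hef : lor e f < 0) (hs : 0 < s) :
    (horo e s ∩ horo f t).Nonempty ↔ -lor e f ≤ 2 * (s * t) := by
  constructor
  · rintro ⟨x, hxe, hxf⟩
    rw [mem_horo] at hxe hxf
    have := x.neg_lor_le he hf
    nlinarith [x.lor_neg he, x.lor_neg hf]
  · intro h
    obtain ⟨x, hxe, hxf⟩ := exists_edgePoint he hf hs
      (div_pos (neg_pos.2 hef) (by positivity : 0 < 2 * s)) (by field_simp)
    exact ⟨x, hxe.le, hxf.trans_le ((div_le_iff₀ (by positivity)).2 (by linarith))⟩

theorem levels_eq_of_mem_inter (he : IsIdealPoint e) (hf : IsIdealPoint f)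
    (hst : 2 * (s * t) ≤ -lor e f) {x : Hyp n} (hx : x ∈ horo e s ∩ horo f t) :
    -lor x.1 e = s ∧ -lor x.1 f = t := by
  obtain ⟨hxe, hxf⟩ := hx
  rw [mem_horo] at hxe hxf
  have := x.neg_lor_le he hf
  have := x.lor_neg he
  have := x.lor_neg hf
  constructor <;> nlinarith

theorem eq_edgePoint_of_mem_inter (he : IsIdealPoint e) (hf : IsIdealPoint f)
    (hst : 2 * (s * t) ≤ -lor e f) {x : Hyp n} (hx : x ∈ horo e s ∩ horo f t) :
    x.1 = (2 * s)⁻¹ • e + (2 * t)⁻¹ • f := by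
  obtain ⟨rfl, rfl⟩ := levels_eq_of_mem_inter he hf hst hx
  exact x.eq_edgePoint he hf (by linarith [x.neg_lor_le he hf])

theorem horo_inter_horo_subsingleton_iff (he : IsIdealPoint e) (hf : IsIdealPoint f)
    (hef : lor e f < 0) (hs : 0 < s) (ht : 0 < t) :
    (horo e s ∩ horo f t).Subsingleton ↔ 2 * (s * t) ≤ -lor e f := by
  refine ⟨fun h => ?_, fun h x hx y hy => Subtype.ext ?_⟩
  · by_contra! hlt
    have hc : 0 < -lor e f := neg_pos.2 hef
    obtain ⟨x, hxe, hxf⟩ := exists_edgePoint he hf hs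
      (div_pos hc (by positivity : 0 < 2 * s)) (by field_simp)
    obtain ⟨y, hye, hyf⟩ := exists_edgePoint he hf
      (div_pos hc (by positivity : 0 < 2 * t)) ht (by field_simp)
    have hxt : -lor e f / (2 * s) < t := (div_lt_iff₀ (by positivity)).2 (by linarith)
    have hys : -lor e f / (2 * t) < s := (div_lt_iff₀ (by positivity)).2 (by linarith)
    have hxy : x = y := h ⟨hxe.le, hxf.trans_le hxt.le⟩ ⟨hye.trans_le hys.le, hyf.le⟩
    exact hys.ne (by rw [← hye, ← hxy, hxe])
  · rw [eq_edgePoint_of_mem_inter he hf h hx, eq_edgePoint_of_mem_inter he hf h hy]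

theorem touch_iff {A B : Set (Hyp n)} : Touch A B ↔ (A ∩ B).Nonempty ∧ (A ∩ B).Subsingleton :=
  Set.exists_eq_singleton_iff_nonempty_subsingleton

theorem touch_horo_iff (he : IsIdealPoint e) (hf : IsIdealPoint f) (hef : lor e f < 0)
    (hs : 0 < s) (ht : 0 < t) : Touch (horo e s) (horo f t) ↔ 2 * (s * t) = -lor e f := by
  rw [touch_iff, horo_inter_horo_nonempty_iff he hf hef hs,
    horo_inter_horo_subsingleton_iff he hf hef hs ht, and_comm, le_antisymm_iff]

theorem disjoint_interior_horo_iff (he : IsIdealPoint e) (hf : IsIdealPoint f)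
    (hef : lor e f < 0) (hs : 0 < s) (ht : 0 < t) :
    Disjoint (interior (horo e s)) (interior (horo f t)) ↔ 2 * (s * t) ≤ -lor e f := by
  rw [interior_horo he, interior_horo hf, Set.disjoint_left]
  refine ⟨fun h => ?_, fun h x (hxe : -lor x.1 e < s) (hxf : -lor x.1 f < t) => ?_⟩
  · by_contra! hlt
    have hc : 0 < -lor e f := neg_pos.2 hef
    obtain ⟨a, hca, has⟩ : ∃ a, -lor e f / (2 * t) < a ∧ a < s :=
      exists_between ((div_lt_iff₀ (by positivity)).2 (by linarith))
    have ha : 0 < a := (div_pos hc (by positivity)).trans hca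
    obtain ⟨x, hxe, hxf⟩ := exists_edgePoint he hf ha
      (div_pos hc (by positivity : 0 < 2 * a)) (by field_simp)
    rw [div_lt_iff₀ (by positivity)] at hca
    exact h (hxe.trans_lt has) (hxf.trans_lt ((div_lt_iff₀ (by positivity)).2 (by linarith)))
  · have := x.neg_lor_le he hf
    nlinarith [x.lor_neg he, x.lor_neg hf]

/-- The hypotheses on the levels place `p` and `p'` on the geodesic from `e` to `f`. -/
theorem hdist_of_mem_inter (he : IsIdealPoint e) (hf : IsIdealPoint f) {s' t' : ℝ}
    (ht : 0 < t) (ht' : 0 < t') (hst : 2 * (s * t) = -lor e f) (hst' : 2 * (s' * t') = -lor e f)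
    {p p' : Hyp n} (hp : p ∈ horo e s ∩ horo f t) (hp' : p' ∈ horo e s' ∩ horo f t') :
    hdist p p' = |Real.log (t' / t)| := by
  obtain ⟨hpe, hpf⟩ := levels_eq_of_mem_inter he hf hst'.le hp'
  have hs : 0 < s := (levels_eq_of_mem_inter he hf hst.le hp).1 ▸ neg_pos.2 (p.lor_neg he)
  have hcosh : -lor p.1 p'.1 = Real.cosh |Real.log (t' / t)| := by
    rw [Real.cosh_abs, Real.cosh_log (by positivity), eq_edgePoint_of_mem_inter he hf hst.le hp,
      lor_add_left, lor_smul_left, lor_smul_left, lor_comm e, lor_comm f,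
      ← neg_eq_iff_eq_neg.2 hpe.symm, ← neg_eq_iff_eq_neg.2 hpf.symm]
    have : s * t = s' * t' := by linarith
    field_simp
    linear_combination -t * this
  rw [hdist, hcosh, Real.arcosh_cosh (abs_nonneg _)]

end Horoball

section Hyperplane

variable {e ν : LVec n} {t : ℝ}

/-- The hyperplane with normal vector `ν`. -/
def hyperplane (ν : LVec n) : Set (Hyp n) := {x | lor x.1 ν = 0}

theorem mem_hyperplane {x : Hyp n} : x ∈ hyperplane ν ↔ lor x.1 ν = 0 := Iff.rfl

/-- A multiple of the orthogonal projection of `e` to the complement of `ν`. The point of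
`hyperplane ν` closest to `e` is proportional to it. -/
def footVec (e ν : LVec n) : LVec n := lor ν ν • e - lor e ν • ν

theorem lor_footVec_normal (e ν : LVec n) : lor (footVec e ν) ν = 0 := by
  rw [footVec, lor_sub_left, lor_smul_left, lor_smul_left]
  ring

theorem lor_footVec_of_orthogonal {x : LVec n} (hx : lor x ν = 0) :
    lor x (footVec e ν) = lor ν ν * lor x e := by
  rw [footVec, lor_sub_right, lor_smul_right, lor_smul_right, hx, mul_zero, sub_zero]

theorem IsIdealPoint.lor_footVec (he : IsIdealPoint e) : lor (footVec e ν) e = -lor e ν ^ 2 := by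
  rw [footVec, lor_sub_left, lor_smul_left, lor_smul_left, he.1, lor_comm ν e]
  ring

theorem IsIdealPoint.lor_footVec_self (he : IsIdealPoint e) :
    lor (footVec e ν) (footVec e ν) = -(lor ν ν * lor e ν ^ 2) := by
  rw [lor_footVec_of_orthogonal (lor_footVec_normal e ν), he.lor_footVec]
  ring

theorem sq_le_of_mem_hyperplane (he : IsIdealPoint e) (hν : 0 < lor ν ν) {x : Hyp n}
    (hx : x ∈ hyperplane ν) : lor e ν ^ 2 ≤ lor ν ν * lor x.1 e ^ 2 := by
  have h := x.neg_lor_self_le_sq (footVec e ν)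
  rw [he.lor_footVec_self, lor_footVec_of_orthogonal hx] at h
  nlinarith

theorem smul_eq_footVec (he : IsIdealPoint e) {x : Hyp n} (hx : x ∈ hyperplane ν)
    (h : lor ν ν * lor x.1 e ^ 2 = lor e ν ^ 2) :
    (lor ν ν * -lor x.1 e) • x.1 = footVec e ν := by
  have hfoot := x.eq_smul_of_sq_eq (w := footVec e ν) (by
    rw [he.lor_footVec_self, lor_footVec_of_orthogonal hx]
    linear_combination lor ν ν * h)
  rw [hfoot, lor_footVec_of_orthogonal hx, mul_neg]

theorem exists_ne_zero_orthogonal (hn : 2 ≤ n) (x y : LVec n) :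
    ∃ z, z ≠ 0 ∧ lor x z = 0 ∧ lor y z = 0 := by
  have hker := LinearMap.ker_ne_bot_of_finrank_lt (f := (lorForm x).prod (lorForm y))
    (by simp only [Module.finrank_prod, Module.finrank_self, Module.finrank_fin_fun]; omega)
  obtain ⟨z, hz, hz0⟩ := Submodule.exists_mem_ne_zero_of_ne_bot hker
  obtain ⟨hxz, hyz⟩ := Prod.mk_eq_zero.1 (LinearMap.mem_ker.1 hz)
  exact ⟨z, hz0, hxz, hyz⟩

theorem exists_mem_hyperplane (hn : 2 ≤ n) (he : IsIdealPoint e) (hν : 0 < lor ν ν)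
    (heν : lor e ν ≠ 0) (ht : 0 < t) (h : lor e ν ^ 2 ≤ t ^ 2 * lor ν ν) :
    ∃ x ∈ hyperplane ν, -lor x.1 e = t := by
  obtain ⟨z, hz0, hze, hzν⟩ := exists_ne_zero_orthogonal hn e ν
  have hd : 0 < lor e ν ^ 2 := by positivity
  have hzfoot : lor z (footVec e ν) = 0 := by
    rw [lor_footVec_of_orthogonal (lor_comm z ν ▸ hzν), lor_comm z, hze, mul_zero]
  have hz : 0 < lor z z := lor_self_pos
    (by rw [he.lor_footVec_self]; exact neg_neg_of_pos (mul_pos hν hd))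
    (lor_comm z _ ▸ hzfoot) hz0
  obtain ⟨ε, hε⟩ : ∃ ε : ℝ, ε ^ 2 * lor z z = t ^ 2 * lor ν ν / lor e ν ^ 2 - 1 := by
    have h0 : 0 ≤ t ^ 2 * lor ν ν / lor e ν ^ 2 - 1 := sub_nonneg.2 ((one_le_div hd).2 h)
    exact ⟨√((t ^ 2 * lor ν ν / lor e ν ^ 2 - 1) / lor z z),
      by rw [Real.sq_sqrt (by positivity), div_mul_cancel₀ _ hz.ne']⟩
  let y : LVec n := (t / lor e ν ^ 2) • footVec e ν + ε • z
  have hye : lor y e = -t := by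
    rw [lor_add_left, lor_smul_left, lor_smul_left, he.lor_footVec, lor_comm z, hze]
    field_simp
    ring
  have hyν : lor y ν = 0 := by
    rw [lor_add_left, lor_smul_left, lor_smul_left, lor_footVec_normal, lor_comm z, hzν,
      mul_zero, mul_zero, add_zero]
  have hy : lor y y = -1 := by
    simp only [y, lor_add_left, lor_add_right, lor_smul_left, lor_smul_right,
      he.lor_footVec_self, lor_comm _ z, hzfoot]
    field_simp at hε ⊢
    linear_combination hε
  exact ⟨⟨y, hy, pos_of_lor_neg hy he (by rw [hye]; exact neg_neg_of_pos ht)⟩, hyν,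
    by rw [hye, neg_neg]⟩

theorem horo_inter_hyperplane_nonempty_iff (hn : 2 ≤ n) (he : IsIdealPoint e)
    (hν : 0 < lor ν ν) (heν : lor e ν ≠ 0) (ht : 0 < t) :
    (horo e t ∩ hyperplane ν).Nonempty ↔ lor e ν ^ 2 ≤ t ^ 2 * lor ν ν := by
  constructor
  · rintro ⟨x, hxt, hxν⟩
    rw [mem_horo] at hxt
    have := sq_le_of_mem_hyperplane he hν hxν
    have : lor x.1 e ^ 2 ≤ t ^ 2 := by nlinarith [x.lor_neg he]
    nlinarith
  · intro h
    obtain ⟨x, hxν, hxt⟩ := exists_mem_hyperplane hn he hν heν ht h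
    exact ⟨x, hxt.le, hxν⟩

theorem smul_eq_footVec_of_mem_inter (he : IsIdealPoint e) (hν : 0 < lor ν ν)
    (h : t ^ 2 * lor ν ν ≤ lor e ν ^ 2) {x : Hyp n} (hx : x ∈ horo e t ∩ hyperplane ν) :
    (lor ν ν * t) • x.1 = footVec e ν := by
  obtain ⟨hxt, hxν⟩ := hx
  rw [mem_horo] at hxt
  have hxe := x.lor_neg he
  have hle := sq_le_of_mem_hyperplane he hν hxν
  have heq : -lor x.1 e = t := by
    have : t ^ 2 ≤ lor x.1 e ^ 2 := le_of_mul_le_mul_left (by linarith) hν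
    nlinarith
  rw [← heq]
  exact smul_eq_footVec he hxν (le_antisymm (by rw [← heq, neg_sq] at h; linarith) hle)

theorem horo_inter_hyperplane_subsingleton_iff (hn : 2 ≤ n) (he : IsIdealPoint e)
    (hν : 0 < lor ν ν) (heν : lor e ν ≠ 0) (ht : 0 < t) :
    (horo e t ∩ hyperplane ν).Subsingleton ↔ t ^ 2 * lor ν ν ≤ lor e ν ^ 2 := by
  refine ⟨fun h => ?_, fun h x hx y hy => Subtype.ext ?_⟩
  · by_contra! hlt
    have hsq : √(lor e ν ^ 2 / lor ν ν) ^ 2 = lor e ν ^ 2 / lor ν ν := Real.sq_sqrt (by positivity)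
    have hst : √(lor e ν ^ 2 / lor ν ν) < t :=
      (Real.sqrt_lt' ht).2 ((div_lt_iff₀ hν).2 hlt)
    obtain ⟨x, hxν, hxt⟩ := exists_mem_hyperplane hn he hν heν ht hlt.le
    obtain ⟨y, hyν, hys⟩ := exists_mem_hyperplane hn he hν heν
      (Real.sqrt_pos.2 (by positivity : 0 < lor e ν ^ 2 / lor ν ν))
      (by rw [hsq, div_mul_cancel₀ _ hν.ne'])
    have hxy : x = y := h ⟨hxt.le, hxν⟩ ⟨hys.trans_le hst.le, hyν⟩
    exact hst.ne (by rw [← hys, ← hxy, hxt])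
  · exact smul_right_injective _ (mul_pos hν ht).ne'
      ((smul_eq_footVec_of_mem_inter he hν h hx).trans
        (smul_eq_footVec_of_mem_inter he hν h hy).symm)

theorem touch_hyperplane_iff (hn : 2 ≤ n) (he : IsIdealPoint e) (hν : 0 < lor ν ν)
    (heν : lor e ν ≠ 0) (ht : 0 < t) :
    Touch (horo e t) (hyperplane ν) ↔ t ^ 2 * lor ν ν = lor e ν ^ 2 := by
  rw [touch_iff, horo_inter_hyperplane_nonempty_iff hn he hν heν ht,
    horo_inter_hyperplane_subsingleton_iff hn he hν heν ht, and_comm, le_antisymm_iff]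

end Hyperplane

section EdgeFunction

variable {ι : Type*} [Fintype ι]

theorem sum_erase_add [DecidableEq ι] (a : ι → ℝ) (i : ι) :
    ∑ j ∈ Finset.univ.erase i, (a i + a j) = (Fintype.card ι - 2) * a i + ∑ j, a j := by
  rw [Finset.sum_erase_eq_sub (Finset.mem_univ i), Finset.sum_add_distrib, Finset.sum_const,
    Finset.card_univ, nsmul_eq_mul]
  ring

theorem eq_zero_of_sum_erase_add_eq_zero [DecidableEq ι] (hι : 2 < Fintype.card ι)
    {a : ι → ℝ} (h : ∀ i, ∑ j ∈ Finset.univ.erase i, (a i + a j) = 0) : a = 0 := by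
  have hm : (2 : ℝ) < Fintype.card ι := by exact_mod_cast hι
  simp only [sum_erase_add] at h
  have hsum : ∑ j, a j = 0 := by
    have := Finset.sum_congr rfl fun i (_ : i ∈ Finset.univ) => h i
    rw [Finset.sum_add_distrib, ← Finset.mul_sum, Finset.sum_const, Finset.sum_const_zero,
      Finset.card_univ, nsmul_eq_mul] at this
    nlinarith
  funext i
  have hi := h i
  rw [hsum, add_zero] at hi
  exact (mul_eq_zero.1 hi).resolve_left (by linarith)

theorem exists_sum_erase_add_eq [DecidableEq ι] (hι : 2 < Fintype.card ι) (b : ι → ℝ) :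
    ∃ a : ι → ℝ, ∀ i, ∑ j ∈ Finset.univ.erase i, (a i + a j) = b i := by
  have hm : (2 : ℝ) < Fintype.card ι := by exact_mod_cast hι
  have hm2 : (Fintype.card ι : ℝ) - 2 ≠ 0 := by linarith
  have hm1 : 2 * (Fintype.card ι : ℝ) - 2 ≠ 0 := by linarith
  obtain ⟨s, hs⟩ : ∃ s, (2 * (Fintype.card ι : ℝ) - 2) * s = ∑ j, b j :=
    ⟨_, mul_div_cancel₀ _ hm1⟩
  obtain ⟨a, ha⟩ : ∃ a : ι → ℝ, ∀ i, ((Fintype.card ι : ℝ) - 2) * a i = b i - s :=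
    ⟨fun i => _, fun i => mul_div_cancel₀ _ hm2⟩
  have hsum : ∑ j, a j = s := by
    refine mul_left_cancel₀ hm2 ?_
    rw [Finset.mul_sum, Finset.sum_congr rfl fun i _ => ha i, Finset.sum_sub_distrib,
      Finset.sum_const, Finset.card_univ, nsmul_eq_mul, ← hs]
    ring
  exact ⟨a, fun i => by rw [sum_erase_add, ha, hsum, sub_add_cancel]⟩

/-- Permuting the vertices preserves the vanishing of the row sums, so the vertex function by which
the edge function changes has vanishing row sums as well. -/
theorem eq_zero_of_map_eq_add [DecidableEq ι] (hι : 2 < Fintype.card ι)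
    {l : ι → ι → ℝ} (hl : ∀ i, ∑ j ∈ Finset.univ.erase i, l i j = 0) {σ : Equiv.Perm ι} {a : ι → ℝ}
    (h : ∀ i j, i ≠ j → l (σ i) (σ j) = l i j + (a i + a j)) : a = 0 := by
  refine eq_zero_of_sum_erase_add_eq_zero hι fun i => ?_
  have hσ : ∑ j ∈ Finset.univ.erase i, l (σ i) (σ j) = 0 := by
    rw [← hl (σ i)]
    exact Finset.sum_equiv σ (by simp) fun _ _ => rfl
  rw [Finset.sum_congr rfl fun j hj => h i j (Finset.ne_of_mem_erase hj).symm,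
    Finset.sum_add_distrib, hl i, zero_add] at hσ
  exact hσ

/-- Adding a vertex function to `l` makes all its row sums vanish. It is then invariant under the
group, hence constant, hence zero. -/
theorem exists_add_add_eq_zero (hι : 2 < Fintype.card ι) {l : ι → ι → ℝ}
    (hsymm : ∀ i j, l i j = l j i)
    (htrans : ∀ i j i' j', i ≠ j → i' ≠ j' → ∃ (σ : Equiv.Perm ι) (a : ι → ℝ),
      s(σ i, σ j) = s(i', j') ∧ ∀ k m, k ≠ m → l (σ k) (σ m) = l k m + (a k + a m)) :
    ∃ γ : ι → ℝ, ∀ i j, i ≠ j → γ i + γ j + l i j = 0 := by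
  classical
  obtain ⟨γ, hγ⟩ := exists_sum_erase_add_eq hι fun i => -∑ j ∈ Finset.univ.erase i, l i j
  have hbal : ∀ i, ∑ j ∈ Finset.univ.erase i, (γ i + γ j + l i j) = 0 := fun i => by
    rw [Finset.sum_add_distrib, hγ, neg_add_cancel]
  have hconst : ∀ i j i' j', i ≠ j → i' ≠ j' →
      γ i' + γ j' + l i' j' = γ i + γ j + l i j := by
    intro i j i' j' hij hij'
    obtain ⟨σ, a, hσ, ha⟩ := htrans i j i' j' hij hij'
    have h0 := eq_zero_of_map_eq_add hι (l := fun i j => γ i + γ j + l i j) hbal (σ := σ)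
      (a := fun k => a k + (γ (σ k) - γ k)) fun k m hkm => by rw [ha k m hkm]; ring
    have hedge : γ (σ i) + γ (σ j) + l (σ i) (σ j) = γ i' + γ j' + l i' j' := by
      obtain ⟨rfl, rfl⟩ | ⟨rfl, rfl⟩ := Sym2.eq_iff.1 hσ
      · rfl
      · rw [hsymm (σ i), add_comm (γ (σ i))]
    have hi := congrFun h0 i
    have hj := congrFun h0 j
    simp only [Pi.zero_apply] at hi hj
    linarith [ha i j hij]
  refine ⟨γ, fun i j hij => ?_⟩
  have hrow := hbal i
  rw [Finset.sum_congr rfl fun k hk => hconst i j i k hij (Finset.ne_of_mem_erase hk).symm,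
    Finset.sum_const, Finset.card_erase_of_mem (Finset.mem_univ i), Finset.card_univ,
    smul_eq_zero] at hrow
  exact hrow.resolve_left (by omega)

end EdgeFunction

section Normalization

variable {u : Fin (n + 1) → LVec n}

/-- Representatives of the vertices of an ideal simplex for which the horoballs of level `1` are
mutually tangent. -/
structure IsNormalized (u : Fin (n + 1) → LVec n) : Prop where
  isIdealSimplex : IsIdealSimplex u
  lor_eq : ∀ i j, i ≠ j → lor (u i) (u j) = -2

theorem IsIdealSimplex.lor_neg (hu : IsIdealSimplex u) {i j : Fin (n + 1)} (hij : i ≠ j) :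
    lor (u i) (u j) < 0 := by
  refine (hu.1 i).lor_neg (hu.1 j) ?_
  have := hu.2.comp ![i, j] (by
    rintro a b; fin_cases a <;> fin_cases b <;> simp [hij, hij.symm])
  convert this using 1
  funext k
  fin_cases k <;> rfl

theorem IsIdealSimplex.smul (hu : IsIdealSimplex u) {c : Fin (n + 1) → ℝ} (hc : ∀ i, 0 < c i) :
    IsIdealSimplex fun i => c i • u i :=
  ⟨fun i => (hu.1 i).smul (hc i), hu.2.units_smul fun i => Units.mk0 (c i) (hc i).ne'⟩

theorem IsSymmetry.exists_log_eq (hu : IsIdealSimplex u) {g : LVec n ≃ₗ[ℝ] LVec n}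
    {σ : Equiv.Perm (Fin (n + 1))} (h : IsSymmetry u g σ) :
    ∃ a : Fin (n + 1) → ℝ, ∀ i j, i ≠ j →
      Real.log (-lor (u (σ i)) (u (σ j)) / 2) =
        Real.log (-lor (u i) (u j) / 2) + (a i + a j) := by
  obtain ⟨⟨hg, -⟩, hσ⟩ := h
  choose c hc hgc using hσ
  refine ⟨fun i => -Real.log (c i), fun i j hij => ?_⟩
  have hneg := hu.lor_neg (σ.injective.ne hij)
  have hlor : -lor (u i) (u j) / 2 = c i * (c j * (-lor (u (σ i)) (u (σ j)) / 2)) := by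
    rw [← hg, hgc, hgc, lor_smul_left, lor_smul_right]
    ring
  rw [hlor, Real.log_mul (hc i).ne' (by have := hc j; nlinarith),
    Real.log_mul (hc j).ne' (by linarith)]
  ring

theorem IsRegularIdealSimplex.exists_isNormalized (hn : 2 ≤ n) (hu : IsRegularIdealSimplex u) :
    ∃ c : Fin (n + 1) → ℝ, (∀ i, 0 < c i) ∧ IsNormalized fun i => c i • u i := by
  obtain ⟨hsimplex, hreg⟩ := hu
  obtain ⟨γ, hγ⟩ := exists_add_add_eq_zero (by rw [Fintype.card_fin]; omega)
    (l := fun i j => Real.log (-lor (u i) (u j) / 2)) (fun i j => by rw [lor_comm])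
    fun i j i' j' hij hij' => by
      obtain ⟨g, σ, hsymm, hσ⟩ := hreg {i, j} {i', j'} (by
        rw [Finset.card_pair hij, Finset.card_pair hij'])
      obtain ⟨a, ha⟩ := hsymm.exists_log_eq hsimplex
      refine ⟨σ, a, ?_, ha⟩
      rw [Finset.image_insert, Finset.image_singleton, ← Finset.coe_inj] at hσ
      push_cast at hσ
      exact Sym2.eq_iff.2 (Set.pair_eq_pair_iff.1 hσ)
  refine ⟨fun i => Real.exp (γ i), fun i => Real.exp_pos _,
    hsimplex.smul fun i => Real.exp_pos _, fun i j hij => ?_⟩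
  have hpos : 0 < -lor (u i) (u j) / 2 := by linarith [hsimplex.lor_neg hij]
  have hone : Real.exp (γ i) * (Real.exp (γ j) * (-lor (u i) (u j) / 2)) = 1 := by
    rw [← Real.exp_log hpos, ← Real.exp_add, ← Real.exp_add, ← add_assoc, hγ i j hij,
      Real.exp_zero]
  rw [lor_smul_left, lor_smul_right]
  linear_combination -2 * hone

end Normalization

section Level

variable {t : ℝ}

/-- The level at which a horoball centred at a vertex touches the opposite face, for normalized
representatives of the vertices. -/
noncomputable def maxLevel (n : ℕ) : ℝ := √(2 * n / (n - 1))

theorem maxLevel_sq (hn : 2 ≤ n) : maxLevel n ^ 2 = 2 * n / (n - 1) := by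
  have hn' : (2 : ℝ) ≤ n := by exact_mod_cast hn
  exact Real.sq_sqrt (div_nonneg (by linarith) (by linarith))

theorem one_lt_maxLevel (hn : 2 ≤ n) : 1 < maxLevel n := by
  have hn' : (2 : ℝ) ≤ n := by exact_mod_cast hn
  rw [maxLevel, Real.lt_sqrt zero_le_one, one_pow, one_lt_div (by linarith)]
  linarith

theorem maxLevel_pos (hn : 2 ≤ n) : 0 < maxLevel n := zero_lt_one.trans (one_lt_maxLevel hn)

theorem sq_mul_le_iff_le_maxLevel (hn : 2 ≤ n) (ht : 0 < t) :
    t ^ 2 * (n - 1) ≤ 2 * n ↔ t ≤ maxLevel n := by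
  have hn' : (2 : ℝ) ≤ n := by exact_mod_cast hn
  rw [maxLevel, Real.le_sqrt' ht, le_div_iff₀ (by linarith)]

theorem sq_mul_eq_iff_eq_maxLevel (hn : 2 ≤ n) (ht : 0 < t) :
    t ^ 2 * (n - 1) = 2 * n ↔ t = maxLevel n := by
  have hn' : (2 : ℝ) ≤ n := by exact_mod_cast hn
  rw [← pow_left_inj₀ ht.le (maxLevel_pos hn).le two_ne_zero, maxLevel_sq hn,
    eq_div_iff (by linarith)]

end Level

section Coordinates

/-- In the basis of normalized vertices the Lorentz form of a vector with coordinates `a` is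
`-coordForm a`. -/
def coordForm {ι : Type*} [Fintype ι] (a : ι → ℝ) : ℝ := 2 * ((∑ i, a i) ^ 2 - ∑ i, a i ^ 2)

/-- A vector orthogonal to all vertices other than `u i`, when `u` is normalized. -/
def faceNormal (u : Fin (n + 1) → LVec n) (i : Fin (n + 1)) : LVec n := (n : ℝ) • u i - ∑ j, u j

namespace IsNormalized

variable {u : Fin (n + 1) → LVec n}

theorem ideal (hu : IsNormalized u) (i : Fin (n + 1)) : IsIdealPoint (u i) :=
  hu.isIdealSimplex.1 i

theorem linearIndependent (hu : IsNormalized u) : LinearIndependent ℝ u := hu.isIdealSimplex.2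

theorem lor_sum_smul (hu : IsNormalized u) (a : Fin (n + 1) → ℝ) (j : Fin (n + 1)) :
    lor (∑ i, a i • u i) (u j) = 2 * (a j - ∑ i, a i) := by
  have hterm : ∀ i ∈ Finset.univ.erase j, lor (a i • u i) (u j) = -2 * a i := fun i hi => by
    rw [lor_smul_left, hu.lor_eq i j (Finset.ne_of_mem_erase hi), mul_comm]
  rw [lor_sum_left, ← Finset.add_sum_erase _ _ (Finset.mem_univ j), Finset.sum_congr rfl hterm,
    ← Finset.mul_sum, Finset.sum_erase_eq_sub (Finset.mem_univ j), lor_smul_left, (hu.ideal j).1]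
  ring

theorem lor_sum_smul_self (hu : IsNormalized u) (a : Fin (n + 1) → ℝ) :
    lor (∑ i, a i • u i) (∑ i, a i • u i) = -coordForm a := by
  have hterm : ∀ j, a j * (2 * (a j - ∑ i, a i)) = 2 * a j ^ 2 - 2 * (∑ i, a i) * a j :=
    fun j => by ring
  rw [lor_sum_right]
  simp only [lor_smul_right, hu.lor_sum_smul, hterm, Finset.sum_sub_distrib, ← Finset.mul_sum,
    coordForm]
  ring

theorem lor_sum_smul_faceNormal (hu : IsNormalized u) (a : Fin (n + 1) → ℝ) (i : Fin (n + 1)) :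
    lor (∑ j, a j • u j) (faceNormal u i) = 2 * n * a i := by
  rw [faceNormal, lor_sub_right, lor_smul_right, lor_sum_right]
  simp only [hu.lor_sum_smul, ← Finset.mul_sum, Finset.sum_sub_distrib, Finset.sum_const,
    Finset.card_univ, Fintype.card_fin, nsmul_eq_mul]
  push_cast
  ring

theorem lor_faceNormal (hu : IsNormalized u) (i j : Fin (n + 1)) :
    lor (u j) (faceNormal u i) = if i = j then 2 * (n : ℝ) else 0 := by
  simpa [Pi.single_apply, ite_smul] using hu.lor_sum_smul_faceNormal (Pi.single j 1) i

theorem lor_faceNormal_self (hu : IsNormalized u) (i : Fin (n + 1)) :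
    lor (faceNormal u i) (faceNormal u i) = 2 * n * (n - 1) := by
  conv_lhs => arg 1; rw [faceNormal]
  rw [lor_sub_left, lor_smul_left, lor_sum_left]
  simp only [hu.lor_faceNormal, if_true, Finset.sum_ite_eq, Finset.mem_univ]
  ring

theorem lor_faceNormal_self_pos (hu : IsNormalized u) (hn : 2 ≤ n) (i : Fin (n + 1)) :
    0 < lor (faceNormal u i) (faceNormal u i) := by
  have hn' : (2 : ℝ) ≤ n := by exact_mod_cast hn
  rw [hu.lor_faceNormal_self]
  exact mul_pos (by linarith) (by linarith)

theorem exists_eq_sum_smul (hu : IsNormalized u) (v : LVec n) :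
    ∃ a : Fin (n + 1) → ℝ, ∑ i, a i • u i = v := by
  rw [← Submodule.mem_span_range_iff_exists_fun,
    hu.linearIndependent.span_eq_top_of_card_eq_finrank (by simp)]
  exact Submodule.mem_top

theorem oppositeHyperplane_eq (hu : IsNormalized u) (hn : 2 ≤ n) (i : Fin (n + 1)) :
    oppositeHyperplane u i = hyperplane (faceNormal u i) := by
  ext x
  constructor
  · suffices hspan : Submodule.span ℝ (u '' {j | j ≠ i}) ≤
        LinearMap.ker (lorForm.flip (faceNormal u i)) from fun hx => hspan hx
    rw [Submodule.span_le]
    rintro _ ⟨j, hj, rfl⟩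
    exact (hu.lor_faceNormal i j).trans (if_neg (Ne.symm hj))
  · intro hx
    obtain ⟨a, ha⟩ := hu.exists_eq_sum_smul x.1
    rw [mem_hyperplane, ← ha, hu.lor_sum_smul_faceNormal] at hx
    have hai : a i = 0 := (mul_eq_zero.1 hx).resolve_left (by positivity)
    refine Set.mem_ofPred_eq ▸ ha ▸ Submodule.sum_mem _ fun j _ => ?_
    obtain rfl | hj := eq_or_ne j i
    · rw [hai, zero_smul]
      exact Submodule.zero_mem _
    · exact Submodule.smul_mem _ _ (Submodule.subset_span ⟨j, hj, rfl⟩)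

variable {s t : ℝ} {i j : Fin (n + 1)}

theorem touch_horo_iff (hu : IsNormalized u) (hij : i ≠ j) (hs : 0 < s) (ht : 0 < t) :
    Touch (horo (u i) s) (horo (u j) t) ↔ s * t = 1 := by
  rw [HoroballSimplex.touch_horo_iff (hu.ideal i) (hu.ideal j)
    (by rw [hu.lor_eq i j hij]; norm_num) hs ht, hu.lor_eq i j hij]
  constructor <;> intro h <;> linarith

theorem disjoint_interior_horo_iff (hu : IsNormalized u) (hij : i ≠ j) (hs : 0 < s)
    (ht : 0 < t) :
    Disjoint (interior (horo (u i) s)) (interior (horo (u j) t)) ↔ s * t ≤ 1 := by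
  rw [HoroballSimplex.disjoint_interior_horo_iff (hu.ideal i) (hu.ideal j)
    (by rw [hu.lor_eq i j hij]; norm_num) hs ht, hu.lor_eq i j hij]
  constructor <;> intro h <;> linarith

theorem touch_oppositeHyperplane_iff (hu : IsNormalized u) (hn : 2 ≤ n) (ht : 0 < t) :
    Touch (horo (u i) t) (oppositeHyperplane u i) ↔ t = maxLevel n := by
  have hn' : 0 < (n : ℝ) := by positivity
  have heν : lor (u i) (faceNormal u i) = 2 * n := (hu.lor_faceNormal i i).trans (if_pos rfl)
  rw [hu.oppositeHyperplane_eq hn, touch_hyperplane_iff hn (hu.ideal i)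
    (hu.lor_faceNormal_self_pos hn i) (by rw [heν]; positivity) ht, heν,
    hu.lor_faceNormal_self, ← sq_mul_eq_iff_eq_maxLevel hn ht]
  constructor <;> intro h <;> nlinarith

theorem encard_horo_inter_oppositeHyperplane_le_one_iff (hu : IsNormalized u) (hn : 2 ≤ n)
    (ht : 0 < t) : (horo (u i) t ∩ oppositeHyperplane u i).encard ≤ 1 ↔ t ≤ maxLevel n := by
  have hn' : 0 < (n : ℝ) := by positivity
  have heν : lor (u i) (faceNormal u i) = 2 * n := (hu.lor_faceNormal i i).trans (if_pos rfl)
  rw [hu.oppositeHyperplane_eq hn, Set.encard_le_one_iff_subsingleton,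
    horo_inter_hyperplane_subsingleton_iff hn (hu.ideal i)
    (hu.lor_faceNormal_self_pos hn i) (by rw [heν]; positivity) ht, heν,
    hu.lor_faceNormal_self, ← sq_mul_le_iff_le_maxLevel hn ht]
  constructor <;> intro h <;> nlinarith

end IsNormalized

end Coordinates

section CoordForm

theorem continuous_coordForm {ι : Type*} [Fintype ι] :
    Continuous fun a : ι → ℝ => coordForm a := by
  unfold coordForm
  fun_prop

theorem coordForm_nonneg {ι : Type*} [Fintype ι] {a : ι → ℝ} (ha : ∀ i, 0 ≤ a i) :
    0 ≤ coordForm a :=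
  mul_nonneg zero_le_two (sub_nonneg.2 (Finset.sum_sq_le_sq_sum_of_nonneg fun i _ => ha i))

theorem coordForm_smul {ι : Type*} [Fintype ι] (r : ℝ) (a : ι → ℝ) :
    coordForm (r • a) = r ^ 2 * coordForm a := by
  simp only [coordForm, Pi.smul_apply, smul_eq_mul, mul_pow, ← Finset.mul_sum]
  ring

theorem card_mul_coordForm_le {ι : Type*} [Fintype ι] (a : ι → ℝ) :
    Fintype.card ι * coordForm a ≤ 2 * (Fintype.card ι - 1) * (∑ i, a i) ^ 2 := by
  have h := sq_sum_le_card_mul_sum_sq (s := Finset.univ) (f := a)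
  rw [Finset.card_univ] at h
  unfold coordForm
  linarith

theorem coordForm_insertNth (i : Fin (n + 1)) (z : ℝ) (y : Fin n → ℝ) :
    coordForm (i.insertNth z y : Fin (n + 1) → ℝ) = 4 * z * ∑ k, y k + coordForm y := by
  simp only [coordForm, Fin.sum_univ_succAbove _ i, Fin.insertNth_apply_same,
    Fin.insertNth_apply_succAbove]
  ring

theorem coordForm_eq_removeNth (i : Fin (n + 1)) (a : Fin (n + 1) → ℝ) :
    coordForm a = 4 * a i * ∑ k, i.removeNth a k + coordForm (i.removeNth a) := by
  rw [← coordForm_insertNth, Fin.insertNth_self_removeNth]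

end CoordForm

section Slab

variable {t : ℝ}

/-- The nonnegative orthant without the origin. -/
def orthant (n : ℕ) : Set (Fin n → ℝ) := {y | (∀ k, 0 ≤ y k) ∧ 0 < ∑ k, y k}

theorem measurableSet_orthant : MeasurableSet (orthant n) :=
  measurableSet_Ici.inter (measurableSet_lt measurable_const
    (Finset.measurable_sum _ fun k _ => measurable_pi_apply k))

theorem inv_smul_mem_orthant_iff (ht : 0 < t) {y : Fin n → ℝ} :
    t⁻¹ • y ∈ orthant n ↔ y ∈ orthant n := by
  simp only [orthant, Set.mem_ofPred_eq, Pi.smul_apply, smul_eq_mul, ← Finset.mul_sum,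
    mul_nonneg_iff_of_pos_left (inv_pos.2 ht), mul_pos_iff_of_pos_left (inv_pos.2 ht)]

/-- In coordinates, the cone over the part of the horoball of level `t` at vertex `i` that lies on
the inner side of the faces through that vertex, cut off at the hyperboloid. -/
def slab (i : Fin (n + 1)) (t : ℝ) : Set (Fin (n + 1) → ℝ) :=
  {a | i.removeNth a ∈ orthant n ∧
    (2 * ∑ k, i.removeNth a k) ^ 2 ≤ t ^ 2 * coordForm a ∧ coordForm a ≤ 1}

theorem measurableSet_slab (i : Fin (n + 1)) (t : ℝ) : MeasurableSet (slab i t) := by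
  have hremove : Measurable fun a : Fin (n + 1) → ℝ => i.removeNth a :=
    measurable_pi_lambda _ fun k => measurable_pi_apply _
  have hform : Measurable fun a : Fin (n + 1) → ℝ => coordForm a :=
    continuous_coordForm.measurable
  have hsum : Measurable fun a : Fin (n + 1) → ℝ => (2 * ∑ k, i.removeNth a k) ^ 2 := by
    unfold Fin.removeNth
    fun_prop
  exact (hremove measurableSet_orthant).inter
    ((measurableSet_le hsum (hform.const_mul _)).inter (measurableSet_le hform measurable_const))

/-- The length of the fibre of `slab i 1` over `y` in the direction of the vertex `i`. -/
noncomputable def profile : (Fin n → ℝ) → ℝ≥0∞ :=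
  (orthant n).indicator fun y => ENNReal.ofReal ((1 - (2 * ∑ k, y k) ^ 2) / (4 * ∑ k, y k))

theorem measurable_profile : Measurable (profile (n := n)) :=
  Measurable.indicator (by fun_prop) measurableSet_orthant

theorem volume_setOf_insertNth_mem_slab (i : Fin (n + 1)) (ht : 0 < t) (y : Fin n → ℝ) :
    volume {z : ℝ | (i.insertNth z y : Fin (n + 1) → ℝ) ∈ slab i t} =
      ENNReal.ofReal t⁻¹ * profile (t⁻¹ • y) := by
  by_cases hy : y ∈ orthant n
  · have hs : 0 < ∑ k, y k := hy.2
    have hIcc : {z : ℝ | (i.insertNth z y : Fin (n + 1) → ℝ) ∈ slab i t} =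
        Set.Icc (((2 * ∑ k, y k) ^ 2 / t ^ 2 - coordForm y) / (4 * ∑ k, y k))
          ((1 - coordForm y) / (4 * ∑ k, y k)) := by
      ext z
      simp only [slab, Set.mem_ofPred_eq, Fin.removeNth_insertNth, hy, true_and,
        coordForm_insertNth, Set.mem_Icc]
      rw [div_le_iff₀ (by positivity), le_div_iff₀ (by positivity), sub_le_iff_le_add,
        div_le_iff₀ (by positivity), le_sub_iff_add_le, mul_comm (t ^ 2),
        show z * (4 * ∑ k, y k) = 4 * z * ∑ k, y k by ring]
    rw [hIcc, Real.volume_Icc, profile, Set.indicator_of_mem ((inv_smul_mem_orthant_iff ht).2 hy),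
      ← ENNReal.ofReal_mul (inv_pos.2 ht).le]
    simp only [Pi.smul_apply, smul_eq_mul, ← Finset.mul_sum]
    congr 1
    field_simp
    ring
  · rw [profile, Set.indicator_of_notMem (mt (inv_smul_mem_orthant_iff ht).1 hy), mul_zero]
    simp [slab, hy]

theorem lintegral_comp_smul {E : Type*} [NormedAddCommGroup E] [NormedSpace ℝ E]
    [MeasurableSpace E] [BorelSpace E] [FiniteDimensional ℝ E] (μ : Measure E)
    [μ.IsAddHaarMeasure] {f : E → ℝ≥0∞} (hf : Measurable f) {r : ℝ} (hr : r ≠ 0) :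
    ∫⁻ x, f (r • x) ∂μ = ENNReal.ofReal |(r ^ Module.finrank ℝ E)⁻¹| * ∫⁻ x, f x ∂μ := by
  rw [← lintegral_map hf (measurable_const_smul r), Measure.map_addHaar_smul μ hr,
    lintegral_smul_measure, smul_eq_mul]

theorem volume_slab (hn : n ≠ 0) (i : Fin (n + 1)) (ht : 0 < t) :
    volume (slab i t) = ENNReal.ofReal (t ^ (n - 1)) * ∫⁻ y : Fin n → ℝ, profile y := by
  have hprofile : Measurable fun y : Fin n → ℝ => profile (t⁻¹ • y) :=
    measurable_profile.comp (measurable_const_smul _)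
  have hpow : t⁻¹ * |(t⁻¹ ^ n)⁻¹| = t ^ (n - 1) := by
    rw [inv_pow, inv_inv, abs_of_pos (pow_pos ht n), ← mul_pow_sub_one hn,
      inv_mul_cancel_left₀ ht.ne']
  calc volume (slab i t)
    _ = volume ((MeasurableEquiv.piFinSuccAbove (fun _ => ℝ) i).symm ⁻¹' slab i t) :=
        ((volume_preserving_piFinSuccAbove (fun _ => ℝ) i).symm _).measure_preimage_equiv _ |>.symm
    _ = ∫⁻ y, volume {z : ℝ | (i.insertNth z y : Fin (n + 1) → ℝ) ∈ slab i t} := by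
        rw [Measure.volume_eq_prod, Measure.prod_apply_symm
          ((MeasurableEquiv.piFinSuccAbove (fun _ => ℝ) i).symm.measurable
            (measurableSet_slab i t))]
        rfl
    _ = ENNReal.ofReal t⁻¹ * ∫⁻ y : Fin n → ℝ, profile (t⁻¹ • y) := by
        simp only [volume_setOf_insertNth_mem_slab i ht, lintegral_const_mul _ hprofile]
    _ = ENNReal.ofReal (t ^ (n - 1)) * ∫⁻ y : Fin n → ℝ, profile y := by
        rw [lintegral_comp_smul _ measurable_profile (inv_ne_zero ht.ne'), ← mul_assoc,
          ← ENNReal.ofReal_mul (inv_pos.2 ht).le, Module.finrank_fin_fun, hpow]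

theorem lintegral_profile_pos (hn : n ≠ 0) : 0 < ∫⁻ y : Fin n → ℝ, profile y := by
  have : Nonempty (Fin n) := Fin.pos_iff_nonempty.1 (Nat.pos_of_ne_zero hn)
  let U : Set (Fin n → ℝ) := (⋂ k, {y | 0 < y k}) ∩ {y | 2 * ∑ k, y k < 1}
  have hU : IsOpen U := (isOpen_iInter_of_finite fun k =>
    isOpen_lt continuous_const (continuous_apply k)).inter (isOpen_lt (by fun_prop) (by fun_prop))
  have hne : U.Nonempty := by
    refine ⟨fun _ => (2 * (n + 1))⁻¹, Set.mem_iInter.2 fun k => ?_, ?_⟩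
    · rw [Set.mem_ofPred_eq]
      positivity
    · rw [Set.mem_ofPred_eq, Finset.sum_const, Finset.card_univ, Fintype.card_fin, nsmul_eq_mul]
      field_simp
      linarith
  rw [lintegral_pos_iff_support measurable_profile]
  refine (hU.measure_pos volume hne).trans_le (measure_mono fun y ⟨hy, hy1⟩ => ?_)
  have hy : ∀ k, 0 < y k := fun k => Set.mem_iInter.1 hy k
  have hy1 : 2 * ∑ k, y k < 1 := hy1
  have hs : 0 < ∑ k, y k := Finset.sum_pos (fun k _ => hy k) Finset.univ_nonempty
  have hyo : y ∈ orthant n := ⟨fun k => (hy k).le, hs⟩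
  rw [Function.mem_support, profile, Set.indicator_of_mem hyo]
  exact (ENNReal.ofReal_pos.2 (div_pos (by nlinarith) (by linarith))).ne'

theorem inv_sum_le_prod_rpow {ι : Type*} [Fintype ι] [Nonempty ι] {y : ι → ℝ}
    (hy : ∀ k, 0 < y k) : (∑ k, y k)⁻¹ ≤ ∏ k, y k ^ (-(1 / (Fintype.card ι : ℝ))) := by
  have hs : 0 < ∑ k, y k := Finset.sum_pos (fun k _ => hy k) Finset.univ_nonempty
  calc (∑ k, y k)⁻¹
    _ = ∏ _k : ι, (∑ k, y k) ^ (-(1 / (Fintype.card ι : ℝ))) := by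
        rw [Finset.prod_const, Finset.card_univ, ← Real.rpow_natCast, ← Real.rpow_mul hs.le,
          neg_mul, one_div, inv_mul_cancel₀ (by positivity), Real.rpow_neg_one]
    _ ≤ ∏ k, y k ^ (-(1 / (Fintype.card ι : ℝ))) :=
        Finset.prod_le_prod (fun k _ => Real.rpow_nonneg hs.le _) fun k _ =>
          Real.rpow_le_rpow_of_nonpos (hy k)
            (Finset.single_le_sum (fun j _ => (hy j).le) (Finset.mem_univ k))
            (neg_nonpos.2 (by positivity))

theorem lintegral_profile_lt_top (hn : 2 ≤ n) : ∫⁻ y : Fin n → ℝ, profile y < ⊤ := by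
  have hn' : (2 : ℝ) ≤ n := by exact_mod_cast hn
  have : Nonempty (Fin n) := ⟨⟨0, by omega⟩⟩
  let h : ℝ → ℝ := (Set.Ioc 0 1).indicator fun x => x ^ (-(1 / (n : ℝ)))
  have hh0 : ∀ x, 0 ≤ h x :=
    Set.indicator_nonneg fun x hx => Real.rpow_nonneg hx.1.le _
  have hint : Integrable h := by
    rw [integrable_indicator_iff measurableSet_Ioc,
      ← intervalIntegrable_iff_integrableOn_Ioc_of_le zero_le_one]
    exact intervalIntegral.intervalIntegrable_rpow'
      (neg_lt_neg ((div_lt_one (by linarith)).2 (by linarith)))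
  have hprod : Integrable fun y : Fin n → ℝ => ∏ k, h (y k) :=
    Integrable.fintype_prod (f := fun _ => h) fun _ => hint
  refine lt_of_le_of_lt (lintegral_mono_ae ?_) hprod.lintegral_lt_top
  filter_upwards [ae_all_iff.2 fun k => Measure.ae_eval_ne (fun _ => volume) k 0] with y hy
  refine Set.indicator_apply_le' (fun hyo => ENNReal.ofReal_le_ofReal ?_) fun _ => zero_le
  have hpos : ∀ k, 0 < y k := fun k => (hyo.1 k).lt_of_ne (hy k).symm
  have hs : 0 < ∑ k, y k := hyo.2
  obtain hs1 | hs1 := le_or_gt (∑ k, y k) 1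
  · have hhy : ∀ k, h (y k) = y k ^ (-(1 / (n : ℝ))) := fun k =>
      Set.indicator_of_mem (Set.mem_Ioc.2 ⟨hpos k,
        (Finset.single_le_sum (fun j _ => hyo.1 j) (Finset.mem_univ k)).trans hs1⟩) _
    have hle := inv_sum_le_prod_rpow hpos
    rw [Fintype.card_fin] at hle
    simp only [hhy]
    refine le_trans ?_ hle
    rw [div_le_iff₀ (by linarith)]
    field_simp
    nlinarith
  · exact (div_nonpos_of_nonpos_of_nonneg (by nlinarith) (by linarith)).trans
      (Finset.prod_nonneg fun k _ => hh0 _)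

end Slab

section CoordCone

variable {t : ℝ}

/-- The cone over an ideal simplex, cut off at the hyperboloid, in the coordinates given by
normalized vertices. -/
def coordCone (n : ℕ) : Set (Fin (n + 1) → ℝ) :=
  {a | (∀ i, 0 ≤ a i) ∧ 0 < coordForm a ∧ coordForm a ≤ 1}

theorem removeNth_mem_orthant (i : Fin (n + 1)) {a : Fin (n + 1) → ℝ} (ha : a ∈ coordCone n) :
    i.removeNth a ∈ orthant n := by
  obtain ⟨ha0, ha, -⟩ := ha
  refine ⟨fun k => ha0 _, (Finset.sum_nonneg fun k _ => ha0 _).lt_of_ne' fun hs => ?_⟩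
  have hs : ∑ k, i.removeNth a k = 0 := hs
  rw [coordForm_eq_removeNth i, hs, coordForm, hs] at ha
  have : 0 ≤ ∑ k, i.removeNth a k ^ 2 := Finset.sum_nonneg fun k _ => sq_nonneg _
  linarith

/-- A horoball that does not cross the opposite face is bounded within the simplex by the faces
through its centre only. -/
theorem coordCone_inter_eq_slab (hn : 2 ≤ n) (i : Fin (n + 1)) (ht : 0 < t)
    (htn : t ≤ maxLevel n) :
    coordCone n ∩ {a | (2 * ∑ k, i.removeNth a k) ^ 2 ≤ t ^ 2 * coordForm a} = slab i t := by
  ext a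
  refine ⟨fun ⟨ha, hat⟩ => ⟨removeNth_mem_orthant i ha, hat, ha.2.2⟩, fun ⟨ha, hat, ha1⟩ => ?_⟩
  have hs : 0 < ∑ k, i.removeNth a k := ha.2
  have hn' : (2 : ℝ) ≤ n := by exact_mod_cast hn
  have hform : 0 < coordForm a := by
    have : 0 < t ^ 2 * coordForm a := lt_of_lt_of_le (by positivity) hat
    exact pos_of_mul_pos_right this (sq_nonneg t)
  have hai : 0 ≤ a i := by
    have hface := card_mul_coordForm_le (i.removeNth a)
    rw [Fintype.card_fin] at hface
    have hlevel : t ^ 2 * (n - 1) * coordForm a ≤ 2 * n * coordForm a :=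
      mul_le_mul_of_nonneg_right ((sq_mul_le_iff_le_maxLevel hn ht).2 htn) hform.le
    have hsq : (2 * ∑ k, i.removeNth a k) ^ 2 * (n - 1) ≤ t ^ 2 * coordForm a * (n - 1) :=
      mul_le_mul_of_nonneg_right hat (by linarith)
    have hsplit := coordForm_eq_removeNth i a
    by_contra! hneg
    have : n * (a i * ∑ k, i.removeNth a k) < 0 :=
      mul_neg_of_pos_of_neg (by linarith) (mul_neg_of_neg_of_pos hneg hs)
    nlinarith
  exact ⟨⟨fun j => (Fin.eq_self_or_eq_succAbove i j).elim (fun hj => hj ▸ hai)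
    fun ⟨k, hk⟩ => hk ▸ ha.1 k, hform, ha1⟩, hat⟩

theorem coordCone_subset_iUnion_slab : coordCone n ⊆ ⋃ i, slab i (√n) := by
  intro a ha
  obtain ⟨i, -, hi⟩ := Finset.exists_max_image Finset.univ a Finset.univ_nonempty
  have hs := removeNth_mem_orthant i ha
  have hle : ∑ k, i.removeNth a k ≤ n * a i := by
    have := Finset.sum_le_card_nsmul Finset.univ (fun k => i.removeNth a k) (a i)
      fun k _ => hi _ (Finset.mem_univ _)
    simpa using this
  have hform := coordForm_nonneg hs.1
  refine Set.mem_iUnion.2 ⟨i, hs, ?_, ha.2.2⟩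
  rw [Real.sq_sqrt n.cast_nonneg, coordForm_eq_removeNth i a]
  nlinarith [hs.2, mul_nonneg n.cast_nonneg hform]

theorem volume_coordCone_lt_top (hn : 2 ≤ n) : volume (coordCone n) < ⊤ := by
  refine (measure_mono coordCone_subset_iUnion_slab).trans_lt
    ((measure_iUnion_fintype_le _ _).trans_lt (ENNReal.sum_lt_top.2 fun i _ => ?_))
  rw [volume_slab (by omega) i (by positivity)]
  exact ENNReal.mul_lt_top ENNReal.ofReal_lt_top (lintegral_profile_lt_top hn)

theorem volume_coordCone_pos (hn : 2 ≤ n) : 0 < volume (coordCone n) := by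
  refine lt_of_lt_of_le ?_ (measure_mono
    ((coordCone_inter_eq_slab hn 0 (maxLevel_pos hn) le_rfl).symm.subset.trans
      Set.inter_subset_left))
  rw [volume_slab (by omega) 0 (maxLevel_pos hn)]
  exact ENNReal.mul_pos (ENNReal.ofReal_pos.2 (pow_pos (maxLevel_pos hn) _)).ne'
    (lintegral_profile_pos (by omega)).ne'

end CoordCone

section Volume

variable {u : Fin (n + 1) → LVec n} {t : ℝ}

/-- The factor relating hyperbolic volume to Lebesgue measure in the coordinates with respect to
the basis `u`. -/
noncomputable def volFactor (u : Fin (n + 1) → LVec n) : ℝ≥0∞ :=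
  (n + 1) * ENNReal.ofReal |LinearMap.det (Fintype.linearCombination ℝ u)|

theorem volFactor_lt_top (u : Fin (n + 1) → LVec n) : volFactor u < ⊤ :=
  ENNReal.mul_lt_top (by finiteness) ENNReal.ofReal_lt_top

theorem volFactor_pos (hu : LinearIndependent ℝ u) : 0 < volFactor u := by
  have hdet : LinearMap.det (Fintype.linearCombination ℝ u) ≠ 0 :=
    (LinearEquiv.ofInjectiveEndo _
      (linearIndependent_iff_injective_fintypeLinearCombination.1 hu)).isUnit_det'.ne_zero
  exact ENNReal.mul_pos (by simp) (ENNReal.ofReal_pos.2 (abs_pos.2 hdet)).ne'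

namespace IsNormalized

theorem exists_hyp_eq_sum_smul (hu : IsNormalized u) {a : Fin (n + 1) → ℝ} (ha : ∀ i, 0 ≤ a i)
    (ha1 : coordForm a = 1) : ∃ x : Hyp n, x.1 = ∑ i, a i • u i := by
  have hself : lor (∑ i, a i • u i) (∑ i, a i • u i) = -1 := by rw [hu.lor_sum_smul_self, ha1]
  have hsum : 0 < ∑ k, Fin.removeNth 0 a k :=
    (removeNth_mem_orthant 0 ⟨ha, ha1 ▸ zero_lt_one, ha1.le⟩).2
  refine ⟨⟨_, hself, pos_of_lor_neg hself (hu.ideal 0) ?_⟩, rfl⟩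
  rw [hu.lor_sum_smul, Fin.sum_univ_succAbove a 0]
  simp only [Fin.removeNth] at hsum
  linarith

theorem hypVol_eq (hu : IsNormalized u) {K : Set (Fin (n + 1) → ℝ)}
    (hK : ∀ a ∈ K, ∀ i, 0 ≤ a i) (hKsmul : ∀ r : ℝ, 0 < r → ∀ a ∈ K, r • a ∈ K)
    {A : Set (Hyp n)} (hA : ∀ x, x ∈ A ↔ ∃ a ∈ K, x.1 = ∑ i, a i • u i) :
    hypVol A = volFactor u * volume (K ∩ {a | 0 < coordForm a ∧ coordForm a ≤ 1}) := by
  have hcone : {v : LVec n | ∃ x ∈ A, ∃ r : ℝ, 0 < r ∧ r ≤ 1 ∧ v = r • x.1} =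
      Fintype.linearCombination ℝ u '' (K ∩ {a | 0 < coordForm a ∧ coordForm a ≤ 1}) := by
    ext v
    constructor
    · rintro ⟨x, hx, r, hr, hr1, rfl⟩
      obtain ⟨a, ha, hxa⟩ := (hA x).1 hx
      have hform : coordForm (r • a) = r ^ 2 := by
        rw [coordForm_smul, ← neg_neg (coordForm a), ← hu.lor_sum_smul_self, ← hxa, x.lor_self,
          neg_neg, mul_one]
      refine ⟨r • a, ⟨hKsmul r hr a ha, hform ▸ pow_pos hr 2, hform ▸ pow_le_one₀ hr.le hr1⟩, ?_⟩
      rw [map_smul, Fintype.linearCombination_apply, hxa]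
    · rintro ⟨a, ⟨ha, hpos, hle⟩, rfl⟩
      have hr : 0 < √(coordForm a) := Real.sqrt_pos.2 hpos
      have hra := hKsmul _ (inv_pos.2 hr) a ha
      have hform : coordForm ((√(coordForm a))⁻¹ • a) = 1 := by
        rw [coordForm_smul, inv_pow, Real.sq_sqrt hpos.le, inv_mul_cancel₀ hpos.ne']
      obtain ⟨x, hx⟩ := hu.exists_hyp_eq_sum_smul (hK _ hra) hform
      refine ⟨x, (hA x).2 ⟨_, hra, hx⟩, _, hr, Real.sqrt_le_one.2 hle, ?_⟩
      rw [hx, ← Fintype.linearCombination_apply, map_smul, smul_inv_smul₀ hr.ne']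
  rw [hypVol, hcone, Measure.addHaar_image_linearMap, ← mul_assoc, volFactor]

theorem hypVol_simplex (hu : IsNormalized u) :
    hypVol (simplex u) = volFactor u * volume (coordCone n) :=
  hu.hypVol_eq (K := {a | ∀ i, 0 ≤ a i}) (fun _ ha => ha)
    (fun _ hr _ ha i => mul_nonneg hr.le (ha i)) fun _ => Iff.rfl

theorem mem_horo_iff (hu : IsNormalized u) (i : Fin (n + 1)) (ht : 0 < t) {x : Hyp n}
    {a : Fin (n + 1) → ℝ} (ha : ∀ i, 0 ≤ a i) (hx : x.1 = ∑ i, a i • u i) :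
    x ∈ horo (u i) t ↔ (2 * ∑ k, i.removeNth a k) ^ 2 ≤ t ^ 2 * coordForm a := by
  have hform : coordForm a = 1 := by
    rw [← neg_neg (coordForm a), ← hu.lor_sum_smul_self, ← hx, x.lor_self, neg_neg]
  have hlevel : -lor x.1 (u i) = 2 * ∑ k, i.removeNth a k := by
    rw [hx, hu.lor_sum_smul, Fin.sum_univ_succAbove a i]
    simp only [Fin.removeNth]
    ring
  have hsum : 0 ≤ 2 * ∑ k, i.removeNth a k :=
    mul_nonneg zero_le_two (Finset.sum_nonneg fun k _ => ha _)
  rw [mem_horo, hlevel, hform, mul_one, pow_le_pow_iff_left₀ hsum ht.le two_ne_zero]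

theorem hypVol_horo_inter_simplex (hu : IsNormalized u) (hn : 2 ≤ n) (i : Fin (n + 1))
    (ht : 0 < t) (htn : t ≤ maxLevel n) :
    hypVol (horo (u i) t ∩ simplex u) = volFactor u * volume (slab i t) := by
  let K : Set (Fin (n + 1) → ℝ) :=
    {a | (∀ i, 0 ≤ a i) ∧ (2 * ∑ k, i.removeNth a k) ^ 2 ≤ t ^ 2 * coordForm a}
  have hKsmul : ∀ r : ℝ, 0 < r → ∀ a ∈ K, r • a ∈ K := by
    refine fun r hr a ha => ⟨fun j => mul_nonneg hr.le (ha.1 j), ?_⟩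
    have hsum : ∑ k, i.removeNth (r • a) k = r * ∑ k, i.removeNth a k :=
      (Finset.mul_sum ..).symm
    rw [coordForm_smul, hsum, mul_left_comm, mul_pow, mul_left_comm (t ^ 2)]
    exact mul_le_mul_of_nonneg_left ha.2 (sq_nonneg r)
  have hK : K ∩ {a | 0 < coordForm a ∧ coordForm a ≤ 1} = slab i t := by
    rw [← coordCone_inter_eq_slab hn i ht htn]
    exact Set.inter_right_comm ..
  rw [← hK]
  refine hu.hypVol_eq (fun _ ha => ha.1) hKsmul fun x => ⟨?_, ?_⟩
  · rintro ⟨hxt, a, ha, hx⟩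
    exact ⟨a, ⟨ha, (hu.mem_horo_iff i ht ha hx).1 hxt⟩, hx⟩
  · rintro ⟨a, ⟨ha, hat⟩, hx⟩
    exact ⟨(hu.mem_horo_iff i ht ha hx).2 hat, a, ha, hx⟩

end IsNormalized

/-- The part of the volume of an ideal simplex with normalized vertices that the horoball of
level `1` at a vertex covers. -/
noncomputable def cuspRatio (n : ℕ) : ℝ :=
  (∫⁻ y : Fin n → ℝ, profile y).toReal / (volume (coordCone n)).toReal

theorem cuspRatio_pos (hn : 2 ≤ n) : 0 < cuspRatio n :=
  div_pos (ENNReal.toReal_pos (lintegral_profile_pos (by omega)).ne'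
      (lintegral_profile_lt_top hn).ne)
    (ENNReal.toReal_pos (volume_coordCone_pos hn).ne' (volume_coordCone_lt_top hn).ne)

theorem IsNormalized.toReal_hypVol_div (hu : IsNormalized u) (hn : 2 ≤ n) (i : Fin (n + 1))
    (ht : 0 < t) (htn : t ≤ maxLevel n) :
    (hypVol (horo (u i) t ∩ simplex u)).toReal / (hypVol (simplex u)).toReal =
      t ^ (n - 1) * cuspRatio n := by
  have hfactor : (volFactor u).toReal ≠ 0 :=
    (ENNReal.toReal_pos (volFactor_pos hu.linearIndependent).ne' (volFactor_lt_top u).ne).ne'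
  rw [hu.hypVol_horo_inter_simplex hn i ht htn, hu.hypVol_simplex, ENNReal.toReal_mul,
    ENNReal.toReal_mul, mul_div_mul_left _ _ hfactor, volume_slab (by omega) i ht,
    ENNReal.toReal_mul, ENNReal.toReal_ofReal (pow_pos ht _).le, mul_div_assoc, cuspRatio]

theorem IsNormalized.hypVol_simplex_pos (hu : IsNormalized u) (hn : 2 ≤ n) :
    0 < hypVol (simplex u) := by
  rw [hu.hypVol_simplex]
  exact ENNReal.mul_pos (volFactor_pos hu.linearIndependent).ne' (volume_coordCone_pos hn).ne'

theorem IsNormalized.hypVol_simplex_lt_top (hu : IsNormalized u) (hn : 2 ≤ n) :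
    hypVol (simplex u) < ⊤ := by
  rw [hu.hypVol_simplex]
  exact ENNReal.mul_lt_top (volFactor_lt_top u) (volume_coordCone_lt_top hn)

end Volume

section Optimization

variable {y M : ℝ} {x : Fin (n + 1) → ℝ}

theorem add_div_sub_add_div {N : ℝ} (hy : y ≠ 0) (hM : M ≠ 0) :
    M + N / M - (y + N / y) = (M - y) * (M * y - N) / (M * y) := by
  field_simp
  ring

theorem add_div_le_add_div {N : ℝ} (hy : 1 ≤ y) (hyM : y ≤ M) (hNM : N ≤ M) :
    y + N / y ≤ M + N / M := by
  have hM : 0 < M := by linarith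
  have hMy : N ≤ M * y := hNM.trans (le_mul_of_one_le_right hM.le hy)
  rw [← sub_nonneg, add_div_sub_add_div (by linarith) hM.ne']
  exact div_nonneg (mul_nonneg (by linarith) (by linarith)) (by positivity)

theorem add_div_eq_add_div_iff {N : ℝ} (hy : 1 ≤ y) (hM : 0 < M) (hNM : N ≤ M) :
    y + N / y = M + N / M ↔ y = M ∨ (y = 1 ∧ M = N) := by
  rw [eq_comm, ← sub_eq_zero, add_div_sub_add_div (by linarith) hM.ne', div_eq_zero_iff,
    or_iff_left (by positivity), mul_eq_zero, sub_eq_zero, eq_comm, sub_eq_zero]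
  refine or_congr_right ⟨fun h => ?_, fun ⟨h, hMN⟩ => by rw [h, hMN, mul_one]⟩
  have : y = 1 := by nlinarith
  exact ⟨this, by rwa [this, mul_one] at h⟩

/-- The family with value `y` at `k` whose product with each of the other, equal values is `1`. -/
noncomputable def oneLarge (k : Fin (n + 1)) (y : ℝ) : Fin (n + 1) → ℝ :=
  Function.update (fun _ => y⁻¹) k y

theorem oneLarge_self (k : Fin (n + 1)) (y : ℝ) : oneLarge k y k = y := Function.update_self ..

theorem oneLarge_of_ne {i k : Fin (n + 1)} (hik : i ≠ k) (y : ℝ) : oneLarge k y i = y⁻¹ :=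
  Function.update_of_ne hik ..

theorem eq_oneLarge_iff {k : Fin (n + 1)} :
    x = oneLarge k y ↔ x k = y ∧ ∀ i ≠ k, x i = y⁻¹ := Function.eq_update_iff

theorem oneLarge_one (k : Fin (n + 1)) : oneLarge k 1 = 1 := by
  rw [eq_comm, eq_oneLarge_iff]
  exact ⟨rfl, fun _ _ => inv_one.symm⟩

theorem oneLarge_pow (k : Fin (n + 1)) (y : ℝ) (m : ℕ) :
    oneLarge k y ^ m = oneLarge k (y ^ m) := by
  rw [eq_oneLarge_iff]
  refine ⟨by rw [Pi.pow_apply, oneLarge_self], fun i hik => ?_⟩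
  rw [Pi.pow_apply, oneLarge_of_ne hik, inv_pow]

theorem oneLarge_pos (hy : 0 < y) (k i : Fin (n + 1)) : 0 < oneLarge k y i := by
  obtain rfl | hik := eq_or_ne i k
  · rwa [oneLarge_self]
  · rw [oneLarge_of_ne hik]
    exact inv_pos.2 hy

theorem oneLarge_le (hy : 1 ≤ y) (k i : Fin (n + 1)) : oneLarge k y i ≤ y := by
  obtain rfl | hik := eq_or_ne i k
  · rw [oneLarge_self]
  · rw [oneLarge_of_ne hik]
    exact (inv_le_one_of_one_le₀ hy).trans hy

theorem pairwise_oneLarge_mul_le_one (hy : 1 ≤ y) (k : Fin (n + 1)) :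
    Pairwise fun i j => oneLarge k y i * oneLarge k y j ≤ 1 := by
  have hinv := inv_le_one_of_one_le₀ hy
  have hle : y⁻¹ * y ≤ 1 := inv_mul_le_one
  intro i j hij
  obtain rfl | hik := eq_or_ne i k
  · rwa [oneLarge_self, oneLarge_of_ne hij.symm, mul_comm]
  obtain rfl | hjk := eq_or_ne j k
  · rwa [oneLarge_self, oneLarge_of_ne hik]
  · rw [oneLarge_of_ne hik, oneLarge_of_ne hjk]
    exact mul_le_one₀ hinv (by positivity) hinv

theorem sum_oneLarge (k : Fin (n + 1)) (y : ℝ) : ∑ i, oneLarge k y i = y + n / y := by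
  rw [oneLarge, Finset.sum_update_of_mem (Finset.mem_univ k), Finset.sum_const,
    Finset.card_sdiff_of_subset (Finset.subset_univ _), Finset.card_univ, Fintype.card_fin,
    Finset.card_singleton, Nat.add_sub_cancel, nsmul_eq_mul, div_eq_mul_inv]

theorem exists_le_oneLarge (hM : 1 ≤ M) (hx : Pairwise fun i j => x i * x j ≤ 1)
    (hxM : ∀ i, x i ≤ M) : ∃ k y, 1 ≤ y ∧ y ≤ M ∧ ∀ i, x i ≤ oneLarge k y i := by
  obtain ⟨k, -, hk⟩ := Finset.exists_max_image Finset.univ x Finset.univ_nonempty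
  refine ⟨k, max (x k) 1, le_max_right .., max_le (hxM k) hM, fun i => ?_⟩
  obtain rfl | hik := eq_or_ne i k
  · rw [oneLarge_self]
    exact le_max_left ..
  rw [oneLarge_of_ne hik]
  obtain hk1 | hk1 := le_total (x k) 1
  · rw [max_eq_right hk1, inv_one]
    exact (hk i (Finset.mem_univ i)).trans hk1
  · rw [max_eq_left hk1, ← one_div, le_div_iff₀ (zero_lt_one.trans_le hk1)]
    exact hx hik

theorem sum_le_of_pairwise_mul_le_one (hM : 1 ≤ M) (hnM : n ≤ M)
    (hx : Pairwise fun i j => x i * x j ≤ 1) (hxM : ∀ i, x i ≤ M) :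
    ∑ i, x i ≤ M + n / M := by
  obtain ⟨k, y, hy, hyM, hxy⟩ := exists_le_oneLarge hM hx hxM
  calc ∑ i, x i
    _ ≤ ∑ i, oneLarge k y i := Finset.sum_le_sum fun i _ => hxy i
    _ = y + n / y := sum_oneLarge k y
    _ ≤ M + n / M := add_div_le_add_div hy hyM hnM

theorem sum_eq_iff_of_pairwise_mul_le_one (hM : 1 ≤ M) (hnM : n ≤ M)
    (hx : Pairwise fun i j => x i * x j ≤ 1) (hxM : ∀ i, x i ≤ M) :
    ∑ i, x i = M + n / M ↔ (M = n ∧ x = 1) ∨ ∃ k, x = oneLarge k M := by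
  have hM0 : 0 < M := by linarith
  constructor
  · intro hsum
    obtain ⟨k, y, hy, hyM, hxy⟩ := exists_le_oneLarge hM hx hxM
    have hle : ∑ i, x i ≤ ∑ i, oneLarge k y i := Finset.sum_le_sum fun i _ => hxy i
    have hyM := add_div_le_add_div hy hyM hnM
    rw [sum_oneLarge] at hle
    have hxy : x = oneLarge k y := funext fun i => (Finset.sum_eq_sum_iff_of_le fun i _ => hxy i).1
      (by rw [sum_oneLarge]; linarith) i (Finset.mem_univ i)
    obtain rfl | ⟨rfl, hMn⟩ := (add_div_eq_add_div_iff hy hM0 hnM).1 (by linarith)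
    · exact Or.inr ⟨k, hxy⟩
    · exact Or.inl ⟨hMn, hxy.trans (oneLarge_one k)⟩
  · rintro (⟨hMn, rfl⟩ | ⟨k, rfl⟩)
    · rw [← oneLarge_one 0, sum_oneLarge]
      exact (add_div_eq_add_div_iff le_rfl hM0 hnM).2 (Or.inr ⟨rfl, hMn⟩)
    · exact sum_oneLarge k M

end Optimization

section MaxSize

/-- The bound on the size of an admissible horoball, where a horoball of level `t` has size
`t ^ (n - 1)`, proportional to the volume that it cuts out of the simplex. -/
noncomputable def maxSize (n : ℕ) : ℝ := maxLevel n ^ (n - 1)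

theorem one_lt_maxSize (hn : 2 ≤ n) : 1 < maxSize n :=
  one_lt_pow₀ (one_lt_maxLevel hn) (by omega)

theorem log_maxSize (hn : 2 ≤ n) : Real.log (maxSize n) = ((n : ℝ) - 1) * q n := by
  rw [maxSize, Real.log_pow, Nat.cast_sub (by omega), Nat.cast_one]
  rfl

theorem maxSize_eq (hn : n = 2 ∨ n = 3) : maxSize n = n := by
  obtain rfl | rfl := hn
  · have h : maxLevel 2 ^ 2 = 2 ^ 2 := by
      rw [maxLevel_sq le_rfl]
      norm_num
    rw [maxSize, pow_one, (pow_left_inj₀ (maxLevel_pos le_rfl).le zero_le_two two_ne_zero).1 h,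
      Nat.cast_ofNat]
  · rw [maxSize, maxLevel_sq (by norm_num)]
    norm_num

theorem sq_le_two_pow {n : ℕ} (hn : 4 ≤ n) : n ^ 2 ≤ 2 ^ n := by
  induction n, hn using Nat.le_induction with
  | base => norm_num
  | succ n hn ih =>
    rw [pow_succ 2]
    nlinarith

theorem two_lt_one_add_inv_pow {m : ℕ} (hm : 2 ≤ m) : (2 : ℝ) < (1 + (m : ℝ)⁻¹) ^ m := by
  have hm' : (1 : ℝ) < m := by exact_mod_cast hm
  have h := one_add_mul_self_lt_rpow_one_add (s := (m : ℝ)⁻¹)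
    (by linarith [inv_pos.2 (zero_lt_one.trans hm')]) (by positivity) hm'
  rwa [mul_inv_cancel₀ (by positivity), one_add_one_eq_two, Real.rpow_natCast] at h

theorem lt_maxSize (hn : 4 ≤ n) : (n : ℝ) < maxSize n := by
  obtain ⟨m, rfl⟩ : ∃ m, n = m + 1 := ⟨n - 1, by omega⟩
  have hlevel : maxLevel (m + 1) ^ 2 = 2 * (1 + (m : ℝ)⁻¹) := by
    have hm : (m : ℝ) ≠ 0 := by
      rw [Nat.cast_ne_zero]
      omega
    rw [maxLevel_sq (by omega), Nat.cast_add_one, add_sub_cancel_right]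
    field_simp
  refine lt_of_pow_lt_pow_left₀ 2 (zero_lt_one.trans (one_lt_maxSize (by omega))).le ?_
  calc ((m + 1 : ℕ) : ℝ) ^ 2
    _ ≤ 2 ^ m * 2 := by exact_mod_cast sq_le_two_pow hn
    _ < 2 ^ m * (1 + (m : ℝ)⁻¹) ^ m :=
        mul_lt_mul_of_pos_left (two_lt_one_add_inv_pow (by omega)) (by positivity)
    _ = maxSize (m + 1) ^ 2 := by
        rw [maxSize, Nat.add_sub_cancel, pow_right_comm, hlevel, mul_pow]

theorem le_maxSize (hn : 2 ≤ n) : (n : ℝ) ≤ maxSize n := by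
  by_cases h : n = 2 ∨ n = 3
  · exact (maxSize_eq h).ge
  · exact (lt_maxSize (by omega)).le

theorem q_eq (hn : n = 2 ∨ n = 3) : q n = 1 / ((n : ℝ) - 1) * Real.log n := by
  have hn2 : 2 ≤ n := by omega
  have hn' : (2 : ℝ) ≤ n := by exact_mod_cast hn2
  rw [← maxSize_eq hn, log_maxSize hn2, maxSize_eq hn, ← mul_assoc,
    one_div_mul_cancel (by linarith), one_mul]

theorem lt_q (hn : 4 ≤ n) : 1 / ((n : ℝ) - 1) * Real.log n < q n := by
  have hn' : (4 : ℝ) ≤ n := by exact_mod_cast hn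
  rw [one_div_mul_eq_div, div_lt_iff₀' (by linarith), ← log_maxSize (by omega)]
  exact Real.log_lt_log (by linarith) (lt_maxSize hn)

end MaxSize

section Arrangement

variable {u : Fin (n + 1) → LVec n} {t : Fin (n + 1) → ℝ} {k : Fin (n + 1)}
  {B : Fin (n + 1) → Set (Hyp n)}

/-- The arrangement of the horoballs of levels `t` at the ideal points `u`. -/
def arrangement (u : Fin (n + 1) → LVec n) (t : Fin (n + 1) → ℝ) : Fin (n + 1) → Set (Hyp n) :=
  fun i => horo (u i) (t i)

theorem isHoroball_horo {e : LVec n} {s : ℝ} (hs : 0 < s) : IsHoroball e (horo e s) := ⟨s, hs, rfl⟩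

theorem exists_arrangement_eq (h : ∀ i, IsHoroball (u i) (B i)) :
    ∃ t : Fin (n + 1) → ℝ, (∀ i, 0 < t i) ∧ arrangement u t = B := by
  choose t ht hB using h
  exact ⟨t, ht, funext fun i => (hB i).symm⟩

theorem existsUnique_of_arrangement_iff {P : (Fin (n + 1) → Set (Hyp n)) → Prop}
    (hP : ∀ B, P B → ∀ i, IsHoroball (u i) (B i)) {t₀ : Fin (n + 1) → ℝ} (ht₀ : ∀ i, 0 < t₀ i)
    (h : ∀ t : Fin (n + 1) → ℝ, (∀ i, 0 < t i) → (P (arrangement u t) ↔ t = t₀)) : ∃! B, P B := by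
  refine ⟨arrangement u t₀, (h t₀ ht₀).2 rfl, fun B hB => ?_⟩
  obtain ⟨t, ht, rfl⟩ := exists_arrangement_eq (hP B hB)
  rw [(h t ht).1 hB]

theorem eq_one_of_pairwise_mul_eq_one {ι : Type*} [Fintype ι]
    (hι : 2 < Fintype.card ι) {t : ι → ℝ} (ht : ∀ i, 0 < t i)
    (h : Pairwise fun i j => t i * t j = 1) : t = 1 := by
  classical
  funext i
  obtain ⟨j, hj, k, hk, hjk⟩ : ∃ j ∈ Finset.univ.erase i, ∃ k ∈ Finset.univ.erase i, j ≠ k := by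
    rw [← Finset.one_lt_card, Finset.card_erase_of_mem (Finset.mem_univ i), Finset.card_univ]
    omega
  have hij := h (Finset.ne_of_mem_erase hj).symm
  have hik := h (Finset.ne_of_mem_erase hk).symm
  have hsq : t i ^ 2 = 1 := by
    calc t i ^ 2
      _ = t i ^ 2 * (t j * t k) := by rw [h hjk, mul_one]
      _ = t i * t j * (t i * t k) := by ring
      _ = 1 := by rw [hij, hik, one_mul]
  exact (pow_eq_one_iff_of_nonneg (ht i).le two_ne_zero).1 hsq

namespace IsNormalized

theorem isAdmissible_arrangement_iff (hu : IsNormalized u) (hn : 2 ≤ n) (ht : ∀ i, 0 < t i) :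
    IsAdmissible u (arrangement u t) ↔
      (Pairwise fun i j => t i * t j ≤ 1) ∧ ∀ i, t i ≤ maxLevel n := by
  refine ⟨fun h => ⟨fun i j hij => ?_, fun i => ?_⟩, fun ⟨hpack, hface⟩ =>
    ⟨fun i => isHoroball_horo (ht i), fun i j hij => ?_, fun i => ?_⟩⟩
  · exact (hu.disjoint_interior_horo_iff hij (ht i) (ht j)).1 (h.packing i j hij)
  · exact (hu.encard_horo_inter_oppositeHyperplane_le_one_iff hn (ht i)).1 (h.face i)
  · exact (hu.disjoint_interior_horo_iff hij (ht i) (ht j)).2 (hpack hij)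
  · exact (hu.encard_horo_inter_oppositeHyperplane_le_one_iff hn (ht i)).2 (hface i)

theorem isEqualType_arrangement_iff (hu : IsNormalized u) (hn : 2 ≤ n) (ht : ∀ i, 0 < t i) :
    IsEqualType u (arrangement u t) ↔ t = 1 := by
  constructor
  · intro h
    refine eq_one_of_pairwise_mul_eq_one (by rw [Fintype.card_fin]; omega) ht fun i j hij => ?_
    exact (hu.touch_horo_iff hij (ht i) (ht j)).1 (h.touch i j hij)
  · rintro rfl
    have hvol : ∀ i, hypVol (horo (u i) 1 ∩ simplex u) = volFactor u * volume (slab i 1) := fun i =>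
      hu.hypVol_horo_inter_simplex hn i one_pos (one_lt_maxLevel hn).le
    refine ⟨fun i => isHoroball_horo (ht i), fun i j => ?_, fun i j hij => ?_⟩
    · simp only [arrangement, Pi.one_apply, hvol, volume_slab (by omega : n ≠ 0) _ one_pos]
    · exact (hu.touch_horo_iff hij one_pos one_pos).2 (one_mul 1)

theorem isOneMaximal_arrangement_iff (hu : IsNormalized u) (hn : 2 ≤ n) (ht : ∀ i, 0 < t i) :
    IsOneMaximal u k (arrangement u t) ↔ t = oneLarge k (maxLevel n) := by
  have hM := (maxLevel_pos hn).ne'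
  rw [eq_oneLarge_iff]
  refine ⟨fun h => ?_, fun ⟨hk, hi⟩ => ⟨fun i => isHoroball_horo (ht i), ?_, fun i hik => ?_⟩⟩
  · have hk := (hu.touch_oppositeHyperplane_iff hn (ht k)).1 h.touch_face
    refine ⟨hk, fun i hik => ?_⟩
    have hmul := (hu.touch_horo_iff hik (ht i) (ht k)).1 (h.touch i hik)
    rw [hk] at hmul
    exact eq_inv_of_mul_eq_one_left hmul
  · exact (hu.touch_oppositeHyperplane_iff hn (ht k)).2 hk
  · exact (hu.touch_horo_iff hik (ht i) (ht k)).2 (by rw [hi i hik, hk, inv_mul_cancel₀ hM])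

theorem existsUnique_isEqualType (hu : IsNormalized u) (hn : 2 ≤ n) : ∃! B, IsEqualType u B :=
  existsUnique_of_arrangement_iff (fun _ h => h.horoball) (fun _ => one_pos)
    fun _ ht => hu.isEqualType_arrangement_iff hn ht

theorem existsUnique_isOneMaximal (hu : IsNormalized u) (hn : 2 ≤ n) (k : Fin (n + 1)) :
    ∃! B, IsOneMaximal u k B :=
  existsUnique_of_arrangement_iff (fun _ h => h.horoball) (oneLarge_pos (maxLevel_pos hn) k)
    fun _ ht => hu.isOneMaximal_arrangement_iff hn ht

theorem hdist_tangency (hu : IsNormalized u) (hn : 2 ≤ n) {B₀ B₁ : Fin (n + 1) → Set (Hyp n)}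
    {i : Fin (n + 1)} {p₀ p₁ : Hyp n} (h₀ : IsEqualType u B₀) (h₁ : IsOneMaximal u k B₁)
    (hik : i ≠ k) (hp₀ : p₀ ∈ B₀ i ∩ B₀ k) (hp₁ : p₁ ∈ B₁ i ∩ B₁ k) :
    hdist p₀ p₁ = q n := by
  have hM := maxLevel_pos hn
  obtain ⟨t, ht, rfl⟩ := exists_arrangement_eq h₀.horoball
  obtain ⟨s, hs, rfl⟩ := exists_arrangement_eq h₁.horoball
  obtain rfl := (hu.isEqualType_arrangement_iff hn ht).1 h₀
  obtain rfl := (hu.isOneMaximal_arrangement_iff hn hs).1 h₁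
  simp only [arrangement, oneLarge_self, oneLarge_of_ne hik, Pi.one_apply] at hp₀ hp₁
  have hlevels : 2 * (1 * 1) = -lor (u i) (u k) := by
    rw [hu.lor_eq i k hik]
    norm_num
  have hlevels' : 2 * ((maxLevel n)⁻¹ * maxLevel n) = -lor (u i) (u k) := by
    rw [inv_mul_cancel₀ hM.ne', ← hlevels, one_mul]
  rw [hdist_of_mem_inter (hu.ideal i) (hu.ideal k) one_pos hM hlevels hlevels' hp₀ hp₁, div_one,
    abs_of_pos (Real.log_pos (one_lt_maxLevel hn))]
  rfl

theorem density_arrangement (hu : IsNormalized u) (hn : 2 ≤ n) (ht : ∀ i, 0 < t i)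
    (htn : ∀ i, t i ≤ maxLevel n) :
    density u (arrangement u t) = (∑ i, t i ^ (n - 1)) * cuspRatio n := by
  rw [density, Finset.sum_div, Finset.sum_mul]
  exact Finset.sum_congr rfl fun i _ => hu.toReal_hypVol_div hn i (ht i) (htn i)

end IsNormalized

end Arrangement

section Density

variable {u : Fin (n + 1) → LVec n} {B : Fin (n + 1) → Set (Hyp n)}

/-- The density of the optimal arrangements: the large horoball has size `maxSize n`, the `n` other
ones have the inverse size. -/
noncomputable def maxDensity (n : ℕ) : ℝ := (maxSize n + n / maxSize n) * cuspRatio n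

theorem classicalDensity_lt_maxDensity (hn : 4 ≤ n) : (n + 1) * cuspRatio n < maxDensity n := by
  have hM := one_lt_maxSize (n := n) (by omega)
  have hnM := lt_maxSize hn
  refine mul_lt_mul_of_pos_right ?_ (cuspRatio_pos (by omega))
  calc (n : ℝ) + 1
    _ = 1 + n / 1 := by rw [div_one, add_comm]
    _ < maxSize n + n / maxSize n := lt_of_le_of_ne (add_div_le_add_div le_rfl hM.le hnM.le) ?_
  rw [ne_eq, add_div_eq_add_div_iff le_rfl (zero_lt_one.trans hM) hnM.le]
  rintro (h | ⟨-, h⟩)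
  · exact hM.ne h
  · exact hnM.ne' h

theorem pairwise_pow_mul_pow_le_one {ι : Type*} {t : ι → ℝ} (ht : ∀ i, 0 ≤ t i)
    (h : Pairwise fun i j => t i * t j ≤ 1) (m : ℕ) :
    Pairwise fun i j => t i ^ m * t j ^ m ≤ 1 := by
  refine fun i j hij => (mul_pow (t i) (t j) m).symm.trans_le ?_
  exact pow_le_one₀ (mul_nonneg (ht i) (ht j)) (h hij)

theorem pow_left_inj_of_nonneg {ι : Type*} {t s : ι → ℝ} (ht : ∀ i, 0 ≤ t i) (hs : ∀ i, 0 ≤ s i)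
    {m : ℕ} (hm : m ≠ 0) : t ^ m = s ^ m ↔ t = s := by
  simp only [funext_iff, Pi.pow_apply, pow_left_inj₀ (ht _) (hs _) hm]

namespace IsNormalized

theorem density_le_maxDensity (hu : IsNormalized u) (hn : 2 ≤ n) (h : IsAdmissible u B) :
    density u B ≤ maxDensity n := by
  obtain ⟨t, ht, rfl⟩ := exists_arrangement_eq h.horoball
  obtain ⟨hpack, hface⟩ := (hu.isAdmissible_arrangement_iff hn ht).1 h
  rw [hu.density_arrangement hn ht hface]
  refine mul_le_mul_of_nonneg_right ?_ (cuspRatio_pos hn).le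
  exact sum_le_of_pairwise_mul_le_one (one_lt_maxSize hn).le (le_maxSize hn)
    (pairwise_pow_mul_pow_le_one (fun i => (ht i).le) hpack _)
    fun i => pow_le_pow_left₀ (ht i).le (hface i) _

theorem density_eq_maxDensity_iff (hu : IsNormalized u) (hn : 2 ≤ n) (h : IsAdmissible u B) :
    density u B = maxDensity n ↔
      (maxSize n = n ∧ IsEqualType u B) ∨ ∃ k, IsOneMaximal u k B := by
  obtain ⟨t, ht, rfl⟩ := exists_arrangement_eq h.horoball
  obtain ⟨hpack, hface⟩ := (hu.isAdmissible_arrangement_iff hn ht).1 h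
  have hm : n - 1 ≠ 0 := by omega
  have hone : t ^ (n - 1) = 1 ↔ t = 1 := by
    rw [← pow_left_inj_of_nonneg (s := 1) (fun i => (ht i).le) (fun _ => zero_le_one) hm, one_pow]
  have hlarge (k) : t ^ (n - 1) = oneLarge k (maxSize n) ↔ t = oneLarge k (maxLevel n) := by
    rw [← pow_left_inj_of_nonneg (fun i => (ht i).le)
      (fun i => (oneLarge_pos (maxLevel_pos hn) k i).le) hm, oneLarge_pow]
    rfl
  simp only [hu.isEqualType_arrangement_iff hn ht, hu.isOneMaximal_arrangement_iff hn ht, ← hone,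
    ← hlarge]
  rw [hu.density_arrangement hn ht hface, maxDensity, mul_left_inj' (cuspRatio_pos hn).ne']
  exact sum_eq_iff_of_pairwise_mul_le_one (one_lt_maxSize hn).le (le_maxSize hn)
    (pairwise_pow_mul_pow_le_one (fun i => (ht i).le) hpack _)
    fun i => pow_le_pow_left₀ (ht i).le (hface i) _

theorem isAdmissible_arrangement_oneLarge (hu : IsNormalized u) (hn : 2 ≤ n) (k : Fin (n + 1))
    {y : ℝ} (hy : 1 ≤ y) (hyn : y ≤ maxLevel n) : IsAdmissible u (arrangement u (oneLarge k y)) :=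
  (hu.isAdmissible_arrangement_iff hn (oneLarge_pos (zero_lt_one.trans_le hy) k)).2
    ⟨pairwise_oneLarge_mul_le_one hy k, fun i => (oneLarge_le hy k i).trans hyn⟩

theorem isAdmissible_of_isEqualType (hu : IsNormalized u) (hn : 2 ≤ n) (h : IsEqualType u B) :
    IsAdmissible u B := by
  obtain ⟨t, ht, rfl⟩ := exists_arrangement_eq h.horoball
  rw [(hu.isEqualType_arrangement_iff hn ht).1 h, ← oneLarge_one 0]
  exact hu.isAdmissible_arrangement_oneLarge hn 0 le_rfl (one_lt_maxLevel hn).le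

theorem isAdmissible_of_isOneMaximal (hu : IsNormalized u) (hn : 2 ≤ n) {k : Fin (n + 1)}
    (h : IsOneMaximal u k B) : IsAdmissible u B := by
  obtain ⟨t, ht, rfl⟩ := exists_arrangement_eq h.horoball
  rw [(hu.isOneMaximal_arrangement_iff hn ht).1 h]
  exact hu.isAdmissible_arrangement_oneLarge hn k (one_lt_maxLevel hn).le le_rfl

theorem isOptimal_iff_density_eq (hu : IsNormalized u) (hn : 2 ≤ n) :
    IsOptimal u B ↔ IsAdmissible u B ∧ density u B = maxDensity n := by
  refine and_congr_right fun h => ⟨fun hmax => ?_, fun heq B' h' => ?_⟩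
  · obtain ⟨B₁, hB₁, -⟩ := hu.existsUnique_isOneMaximal hn 0
    have hadm := hu.isAdmissible_of_isOneMaximal hn hB₁
    refine (hu.density_le_maxDensity hn h).antisymm ?_
    rw [← (hu.density_eq_maxDensity_iff hn hadm).2 (Or.inr ⟨0, hB₁⟩)]
    exact hmax B₁ hadm
  · rw [heq]
    exact hu.density_le_maxDensity hn h'

theorem isOptimal_iff (hu : IsNormalized u) (hn : 2 ≤ n) :
    IsOptimal u B ↔ (maxSize n = n ∧ IsEqualType u B) ∨ ∃ k, IsOneMaximal u k B := by
  rw [hu.isOptimal_iff_density_eq hn]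
  constructor
  · rintro ⟨hadm, hdensity⟩
    exact (hu.density_eq_maxDensity_iff hn hadm).1 hdensity
  · intro h
    have hadm : IsAdmissible u B := by
      obtain ⟨-, h₀⟩ | ⟨k, h₁⟩ := h
      · exact hu.isAdmissible_of_isEqualType hn h₀
      · exact hu.isAdmissible_of_isOneMaximal hn h₁
    exact ⟨hadm, (hu.density_eq_maxDensity_iff hn hadm).2 h⟩

theorem toReal_hypVol_div_of_isEqualType (hu : IsNormalized u) (hn : 2 ≤ n) (h : IsEqualType u B)
    (i : Fin (n + 1)) :
    (hypVol (B i ∩ simplex u)).toReal / (hypVol (simplex u)).toReal = cuspRatio n := by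
  obtain ⟨t, ht, rfl⟩ := exists_arrangement_eq h.horoball
  obtain rfl := (hu.isEqualType_arrangement_iff hn ht).1 h
  rw [arrangement, hu.toReal_hypVol_div hn i (ht i) (one_lt_maxLevel hn).le, Pi.one_apply, one_pow,
    one_mul]

end IsNormalized

end Density

section Rescaling

variable {E : Fin (n + 1) → LVec n} {c : Fin (n + 1) → ℝ}

theorem isHoroball_smul {e : LVec n} {r : ℝ} (hr : 0 < r) :
    IsHoroball (r • e) = IsHoroball e := by
  have horo_smul : ∀ s, horo (r • e) (r * s) = horo e s := fun s => by
    ext x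
    rw [mem_horo, mem_horo, lor_smul_right, ← mul_neg, mul_le_mul_iff_of_pos_left hr]
  funext B
  refine propext ⟨fun ⟨s, hs, hB⟩ => ⟨s / r, div_pos hs hr, ?_⟩,
    fun ⟨s, hs, hB⟩ => ⟨r * s, mul_pos hr hs, hB.trans (horo_smul s).symm⟩⟩
  change B = horo e (s / r)
  rw [← horo_smul, mul_div_cancel₀ s hr.ne']
  exact hB

theorem simplex_subset_simplex_smul (hc : ∀ i, 0 < c i) :
    simplex E ⊆ simplex fun i => c i • E i := by
  rintro x ⟨a, ha, hx⟩
  refine ⟨fun i => a i / c i, fun i => div_nonneg (ha i) (hc i).le, hx.trans ?_⟩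
  exact Finset.sum_congr rfl fun i _ => by rw [smul_smul, div_mul_cancel₀ _ (hc i).ne']

theorem simplex_smul (hc : ∀ i, 0 < c i) : simplex (fun i => c i • E i) = simplex E := by
  refine (simplex_subset_simplex_smul hc).antisymm' ?_
  rintro x ⟨a, ha, hx⟩
  refine ⟨fun i => a i * c i, fun i => mul_nonneg (ha i) (hc i).le, hx.trans ?_⟩
  exact Finset.sum_congr rfl fun i _ => smul_smul ..

theorem oppositeHyperplane_smul (hc : ∀ i, c i ≠ 0) :
    oppositeHyperplane (fun i => c i • E i) = oppositeHyperplane E := by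
  funext i
  have hspan : Submodule.span ℝ ((fun j => c j • E j) '' {j | j ≠ i}) =
      Submodule.span ℝ (E '' {j | j ≠ i}) := by
    rw [Submodule.span_eq_iSup_of_singleton_spans,
      Submodule.span_eq_iSup_of_singleton_spans (E '' _)]
    simp only [iSup_image, Submodule.span_singleton_smul_eq (hc _).isUnit]
  rw [oppositeHyperplane, oppositeHyperplane, hspan]

theorem density_smul (hc : ∀ i, 0 < c i) : density (fun i => c i • E i) = density E := by
  funext B
  rw [density, density, simplex_smul hc]

theorem isAdmissible_smul (hc : ∀ i, 0 < c i) :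
    IsAdmissible (fun i => c i • E i) = IsAdmissible E := by
  funext B
  apply propext
  constructor <;> exact fun ⟨hhoro, hpack, hface⟩ =>
    ⟨by simpa only [isHoroball_smul (hc _)] using hhoro, hpack,
      by simpa only [oppositeHyperplane_smul fun i => (hc i).ne'] using hface⟩

theorem isOptimal_smul (hc : ∀ i, 0 < c i) : IsOptimal (fun i => c i • E i) = IsOptimal E := by
  funext B
  rw [IsOptimal, IsOptimal, isAdmissible_smul hc, density_smul hc]

theorem isEqualType_smul (hc : ∀ i, 0 < c i) :
    IsEqualType (fun i => c i • E i) = IsEqualType E := by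
  funext B
  apply propext
  constructor <;> exact fun ⟨hhoro, htype, htouch⟩ =>
    ⟨by simpa only [isHoroball_smul (hc _)] using hhoro,
      by simpa only [simplex_smul hc] using htype, htouch⟩

theorem isOneMaximal_smul (hc : ∀ i, 0 < c i) :
    IsOneMaximal (fun i => c i • E i) = IsOneMaximal E := by
  funext k B
  apply propext
  constructor <;> exact fun ⟨hhoro, hface, htouch⟩ =>
    ⟨by simpa only [isHoroball_smul (hc _)] using hhoro,
      by simpa only [oppositeHyperplane_smul fun i => (hc i).ne'] using hface, htouch⟩

end Rescaling

section ClassicalDensity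

variable {E : Fin (n + 1) → LVec n} {B : Fin (n + 1) → Set (Hyp n)}

theorem IsEqualType.toReal_hypVol_div (hn : 2 ≤ n) (hE : IsRegularIdealSimplex E)
    (h : IsEqualType E B) (i : Fin (n + 1)) :
    (hypVol (B i ∩ simplex E)).toReal / (hypVol (simplex E)).toReal = cuspRatio n := by
  obtain ⟨c, hc, hu⟩ := hE.exists_isNormalized hn
  rw [← isEqualType_smul hc] at h
  rw [← simplex_smul hc]
  exact hu.toReal_hypVol_div_of_isEqualType hn h i

theorem isClassicalDensity_iff (hn : 2 ≤ n) (hE : IsRegularIdealSimplex E) (d : ℝ) :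
    IsClassicalDensity n d ↔ d = (n + 1) * cuspRatio n := by
  constructor
  · rintro ⟨E', B, hE', hB, hd⟩
    rw [hd 0, hB.toReal_hypVol_div hn hE']
  · rintro rfl
    obtain ⟨c, hc, hu⟩ := hE.exists_isNormalized hn
    obtain ⟨B, hB, -⟩ := hu.existsUnique_isEqualType hn
    rw [isEqualType_smul hc] at hB
    exact ⟨E, B, hE, hB, fun i => by rw [hB.toReal_hypVol_div hn hE]⟩

end ClassicalDensity

end HoroballSimplex

theorem theorem3p6 (n : ℕ) (hn : 2 ≤ n) (E : Fin (n + 1) → HoroballSimplex.LVec n)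
    (hE : HoroballSimplex.IsRegularIdealSimplex E) :
    -- the density is well defined
    (0 < HoroballSimplex.hypVol (HoroballSimplex.simplex E) ∧
      HoroballSimplex.hypVol (HoroballSimplex.simplex E) < ⊤) ∧
    -- the two basic configurations exist and are uniquely determined
    (∃! B, HoroballSimplex.IsEqualType E B) ∧
    (∀ k, ∃! B, HoroballSimplex.IsOneMaximal E k B) ∧
    -- `q n` is the distance between their tangency points on an edge at the large horoball
    (∀ B₀ B₁ k i p₀ p₁, HoroballSimplex.IsEqualType E B₀ → HoroballSimplex.IsOneMaximal E k B₁ →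
      i ≠ k → B₀ i ∩ B₀ k = {p₀} → B₁ i ∩ B₁ k = {p₁} →
      HoroballSimplex.hdist p₀ p₁ = HoroballSimplex.q n) ∧
    -- the optimal configurations
    (n = 2 ∨ n = 3 →
      HoroballSimplex.q n = 1 / ((n : ℝ) - 1) * Real.log n ∧
      ∀ B, HoroballSimplex.IsOptimal E B ↔
        HoroballSimplex.IsEqualType E B ∨ ∃ k, HoroballSimplex.IsOneMaximal E k B) ∧
    (4 ≤ n →
      1 / ((n : ℝ) - 1) * Real.log n < HoroballSimplex.q n ∧
      ∀ B, HoroballSimplex.IsOptimal E B ↔ ∃ k, HoroballSimplex.IsOneMaximal E k B) ∧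
    -- the congruent-horoball bound is exceeded from dimension four on
    (∃! d, HoroballSimplex.IsClassicalDensity n d) ∧
    (4 ≤ n → ∀ d, HoroballSimplex.IsClassicalDensity n d →
      ∀ B, HoroballSimplex.IsOptimal E B → d < HoroballSimplex.density E B) := by
  open HoroballSimplex in
  obtain ⟨c, hc, hu⟩ := hE.exists_isNormalized hn
  rw [← simplex_smul hc, ← isEqualType_smul hc, ← isOneMaximal_smul hc, ← isOptimal_smul hc,
    ← density_smul hc]
  refine ⟨⟨hu.hypVol_simplex_pos hn, hu.hypVol_simplex_lt_top hn⟩, hu.existsUnique_isEqualType hn,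
    hu.existsUnique_isOneMaximal hn,
    fun B₀ B₁ k i p₀ p₁ h₀ h₁ hik hp₀ hp₁ =>
      hu.hdist_tangency hn h₀ h₁ hik (hp₀ ▸ rfl) (hp₁ ▸ rfl),
    fun h => ⟨q_eq h, fun B => ?_⟩, fun h => ⟨lt_q h, fun B => ?_⟩, ?_, fun h d hd B hB => ?_⟩
  · rw [hu.isOptimal_iff hn, and_iff_right (maxSize_eq h)]
  · rw [hu.isOptimal_iff hn, or_iff_right fun hB => (lt_maxSize h).ne' hB.1]
  · exact ⟨_, (isClassicalDensity_iff hn hE _).2 rfl,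
      fun d hd => (isClassicalDensity_iff hn hE d).1 hd⟩
  · rw [(isClassicalDensity_iff hn hE d).1 hd, ((hu.isOptimal_iff_density_eq hn).1 hB).2]
    exact classicalDensity_lt_maxDensity h
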